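/- Let $M$ be a smooth $2n$-dimensional manifold with an almost skew-Hermitian structure, i.e. a smooth almost complex structure $J$ and a smooth pseudo-Riemannian metric $g$ with $g(JX,JY)=-g(X,Y)$ (so $g$ has signature $(n,n)$), with Levi-Civita connection $\nabla$ and curvature $R(X,Y)=[\nabla_X,\nabla_Y]-\nabla_{[X,Y]}$, $R(X,Y,Z,W)=g(R(X,Y)Z,W)$. For a pseudo-Riemannian metric $h$ on a manifold with Levi-Civita connection $\nabla^h$ and an endomorphism field $K$ of its tangent bundle, put $F_K(x,y,z)=h((\nabla^h_xK)y,z)$; the Lie form of $(K,h)$ is the $1$-form $z\mapsto h^{ij}F_K(e_i,e_j,z)$ ($\{e_i\}$ an arbitrary basis of the tangent space). Let $\theta$ be the Lie form of $(J,g)$ on $M$, and let $\tilde\rho(y,z)=g^{ij}R(e_i,y,z,Je_j)$ be the associated Ricci tensor of $M$. On the tangent bundle $TM$ let $X^H,X^V$ be the horizontal (with respect to $\nabla$) and vertical lifts of a vector field $X$ on $M$. Let $\hat g$ be the Sasaki metric, $\hat g(X^H,Y^H)=\hat g(X^V,Y^V)=g(X,Y)$, $\hat g(X^H,Y^V)=0$,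 and let the almost complex structures $J_1,J_2,J_3$ on $TM$ be given by $$J_1X^H=X^V,\quad J_1X^V=-X^H,\qquad J_2X^H=(JX)^V,\quad J_2X^V=(JX)^H,\qquad J_3=J_1\circ J_2 .$$ Let $\theta_\alpha$ be the Lie form of $(J_\alpha,\hat g)$ on $TM$, $\alpha=1,2,3$. Then: 1. $\theta_1=0$ on $TM$; 2. $\theta_2=0$ on $TM$ if and only if $\theta=0$ and $\tilde\rho=0$ on $M$; 3. $\theta_3=0$ on $TM$ if and only if $\theta=0$ on $M$. -/

import Mathlib

open scoped Manifold ContDiff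
open Bundle

set_option maxSynthPendingDepth 3

noncomputable section

namespace SkewHermitian

/-! ### Linear algebra -/

section Algebra

variable {E : Type*} [NormedAddCommGroup E] [NormedSpace ℝ E]

/-- The contraction `h^{ij} β(e_i, e_j)` of a bilinear form `β` with a nondegenerate symmetric
bilinear form `h` on a finite-dimensional space: the trace of the operator `B` determined by
`h (B x) y = β x y`. -/
def metricTrace (h β : E →L[ℝ] E →L[ℝ] ℝ) : ℝ :=
  LinearMap.trace ℝ E ((h.inverse ∘L β : E →L[ℝ] E) : E →ₗ[ℝ] E)

/-- For `D v = ∂_v h` (the directional derivative of the metric), the Christoffel symbols of the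
first kind `v, w ↦ (z ↦ ½ (∂_v h(w, z) + ∂_w h(v, z) - ∂_z h(v, w)))`. -/
def christoffelFirst (D : E →L[ℝ] E →L[ℝ] E →L[ℝ] ℝ) : E →L[ℝ] E →L[ℝ] E →L[ℝ] ℝ :=
  (1 / 2 : ℝ) • (D + D.flip -
    ((ContinuousLinearMap.flipₗᵢ ℝ E E ℝ : (E →L[ℝ] E →L[ℝ] ℝ) →L[ℝ] E →L[ℝ] E →L[ℝ] ℝ)
      ∘L D.flip))

theorem christoffelFirst_apply (D : E →L[ℝ] E →L[ℝ] E →L[ℝ] ℝ) (v w z : E) :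
    christoffelFirst D v w z = 1 / 2 * (D v w z + D w v z - D z v w) := by
  simp [christoffelFirst]

end Algebra

/-! ### Tensor fields on a manifold and their components in charts -/

section Manifold

variable {E : Type*} [NormedAddCommGroup E] [NormedSpace ℝ E]
  {H : Type*} [TopologicalSpace H] (I : ModelWithCorners ℝ E H)
  {N : Type*} [TopologicalSpace N] [ChartedSpace H N]

variable (N) in
/-- A field of bilinear forms on the tangent spaces of `N`. -/
abbrev FormField : Type _ := ∀ q : N, TangentSpace I q →L[ℝ] TangentSpace I q →L[ℝ] ℝ

variable (N) in
/-- A field of endomorphisms of the tangent spaces of `N`. -/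
abbrev EndField : Type _ := ∀ q : N, TangentSpace I q →L[ℝ] TangentSpace I q

/-- The differential at `x` of the inverse of the preferred chart at `p`: it maps the coordinate
vectors to the coordinate vector fields `∂/∂x^i` at the point with coordinates `x`. -/
def coordFrame (p : N) (x : E) : E →L[ℝ] TangentSpace I ((extChartAt I p).symm x) :=
  mfderiv 𝓘(ℝ, E) I (extChartAt I p).symm x

/-- The differential of the preferred chart at `p`, at the point with coordinates `x`. -/
def coordCoframe (p : N) (x : E) : TangentSpace I ((extChartAt I p).symm x) →L[ℝ] E :=
  mfderiv I 𝓘(ℝ, E) (extChartAt I p) ((extChartAt I p).symm x)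

variable {I}

/-- The value at `p` of a field of bilinear forms, read on the model space `E`. -/
def FormField.val (g : FormField I N) (p : N) : E →L[ℝ] E →L[ℝ] ℝ := g p

/-- The value at `p` of a field of endomorphisms, read on the model space `E`. -/
def EndField.val (J : EndField I N) (p : N) : E →L[ℝ] E := J p

/-- The components of a field of bilinear forms in the preferred chart at `p`, as a function of
the coordinates. -/
def FormField.inChart (g : FormField I N) (p : N) (x : E) : E →L[ℝ] E →L[ℝ] ℝ :=
  (g.val ((extChartAt I p).symm x)).bilinearComp (coordFrame I p x) (coordFrame I p x)

/-- The components of a field of endomorphisms in the preferred chart at `p`, as a function of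
the coordinates. -/
def EndField.inChart (J : EndField I N) (p : N) (x : E) : E →L[ℝ] E :=
  coordCoframe I p x ∘L J ((extChartAt I p).symm x) ∘L coordFrame I p x

/-- The Christoffel symbols `Γ(v, w)^k = Γ^k_{ij} v^i w^j` of the Levi-Civita connection of the
metric `g`, in the preferred chart at `p`, as a function of the coordinates. -/
def christoffel (g : FormField I N) (p : N) (x : E) : E →L[ℝ] E →L[ℝ] E :=
  ContinuousLinearMap.compL ℝ E (E →L[ℝ] ℝ) E (g.inChart p x).inverse ∘L
    christoffelFirst (fderiv ℝ (g.inChart p) x)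

/-- The Christoffel symbols at the point `p` itself, in the preferred chart at `p`. -/
def christoffelAt (g : FormField I N) (p : N) : E →L[ℝ] E →L[ℝ] E :=
  christoffel g p (extChartAt I p p)

/-- The covariant derivative `(∇_x J) y = (∂_x J) y + Γ(x, J y) - J (Γ(x, y))` at the point `p` of a
field of endomorphisms, with respect to the Levi-Civita connection of `g`. -/
def nablaEnd (g : FormField I N) (J : EndField I N) (p : N) : E →L[ℝ] E →L[ℝ] E :=
  fderiv ℝ (J.inChart p) (extChartAt I p p)
    + (ContinuousLinearMap.compL ℝ E E E).flip (J.inChart p (extChartAt I p p)) ∘L christoffelAt g p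
    - ContinuousLinearMap.compL ℝ E E E (J.inChart p (extChartAt I p p)) ∘L christoffelAt g p

/-- The structural tensor `F(x, y, z) = g((∇_x J) y, z)` at `p`, as a bilinear form in `(x, y)` for
fixed `z`. -/
def structural (g : FormField I N) (J : EndField I N) (p : N) (z : TangentSpace I p) :
    E →L[ℝ] E →L[ℝ] ℝ :=
  ContinuousLinearMap.compL ℝ E E ℝ ((g.val p).flip z) ∘L nablaEnd g J p

/-- The Lie form `θ(z) = g^{ij} F(e_i, e_j, z)` at `p`. -/
def lieForm (g : FormField I N) (J : EndField I N) (p : N) (z : TangentSpace I p) : ℝ :=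
  metricTrace (g.val p) (structural g J p z)

/-- The curvature tensor of the Levi-Civita connection of `g` at the point `p`,
`R(x, y) z = (∂_x Γ)(y, z) - (∂_y Γ)(x, z) + Γ(x, Γ(y, z)) - Γ(y, Γ(x, z))`,
i.e. `R(X, Y) = [∇_X, ∇_Y] - ∇_[X, Y]`.  For fixed `y, z` it is given as a linear map in `x`. -/
def curvature (g : FormField I N) (p : N) (y z : E) : E →L[ℝ] E :=
  ((fderiv ℝ (christoffel g p) (extChartAt I p p)).flip y).flip z
    - (fderiv ℝ (christoffel g p) (extChartAt I p p) y).flip z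
    + (christoffelAt g p).flip (christoffelAt g p y z)
    - christoffelAt g p y ∘L (christoffelAt g p).flip z

theorem curvature_apply (g : FormField I N) (p : N) (x y z : E) :
    curvature g p y z x =
      fderiv ℝ (christoffel g p) (extChartAt I p p) x y z
        - fderiv ℝ (christoffel g p) (extChartAt I p p) y x z
        + christoffelAt g p x (christoffelAt g p y z)
        - christoffelAt g p y (christoffelAt g p x z) := by
  simp [curvature]

/-- The associated Ricci tensor `ρ̃(y, z) = g^{ij} R(e_i, y, z, J e_j)` at `p`, where
`R(x, y, z, w) = g(R(x, y) z, w)`. -/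
def associatedRicci (g : FormField I N) (J : EndField I N) (p : N) (y z : TangentSpace I p) : ℝ :=
  metricTrace (g.val p)
    ((g.val p).bilinearComp (curvature g p y z) (J.val p))

end Manifold

/-! ### Almost skew-Hermitian manifolds and the structure on the tangent bundle -/

section TangentBundle

variable {E : Type*} [NormedAddCommGroup E] [NormedSpace ℝ E]
  {H : Type*} [TopologicalSpace H] (I : ModelWithCorners ℝ E H)
  (M : Type*) [TopologicalSpace M] [ChartedSpace H M]

/-- An almost skew-Hermitian structure on `M`: a smooth almost complex structure `J` and a smooth
pseudo-Riemannian metric `g` for which `J` is an anti-isometry on each tangent space.  (Then `g` is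
of neutral signature, and the associated metric is `g(·, J ·)`.) -/
structure AlmostSkewHermitian [IsManifold I ∞ M] where
  /-- the metric -/
  g : FormField I M
  /-- the almost complex structure -/
  J : EndField I M
  smooth_g : ContMDiff I (I.prod 𝓘(ℝ, E →L[ℝ] E →L[ℝ] ℝ)) ∞
    (fun p ↦ TotalSpace.mk' (E →L[ℝ] E →L[ℝ] ℝ) p (g p))
  smooth_J : ContMDiff I (I.prod 𝓘(ℝ, E →L[ℝ] E)) ∞
    (fun p ↦ TotalSpace.mk' (E →L[ℝ] E) p (J p))
  symm : ∀ (p : M) (v w : TangentSpace I p), g p v w = g p w v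
  nondegenerate : ∀ (p : M) (v : TangentSpace I p),
    (∀ w : TangentSpace I p, g p v w = 0) → v = 0
  J_J : ∀ (p : M) (v : TangentSpace I p), J p (J p v) = -v
  anti : ∀ (p : M) (v w : TangentSpace I p), g p (J p v) (J p w) = -g p v w

variable {I M} [IsManifold I ∞ M]

/- The model space of the tangent bundle is `E × E`; the preferred chart of the tangent bundle at
`u` is the one given by the induced coordinates `(x, y)` of the preferred chart of `M` at the base
point of `u`, so that a tangent vector at `u` is the pair of its components along `∂/∂x` and
`∂/∂y`. -/

/-- The vertical lift to `u`, with components `(0, X^k)` in the induced coordinates. -/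
def verticalLift (u : TangentBundle I M) :
    TangentSpace I u.proj →L[ℝ] TangentSpace I.tangent u :=
  (ContinuousLinearMap.inr ℝ E E : E →L[ℝ] E × E)

/-- The horizontal lift to `u` with respect to the Levi-Civita connection of `g`, with components
`(X^k, -y^i Γ^k_{ij} X^j)` in the induced coordinates. -/
def horizontalLift (g : FormField I M) (u : TangentBundle I M) :
    TangentSpace I u.proj →L[ℝ] TangentSpace I.tangent u :=
  ((ContinuousLinearMap.id ℝ E).prod (-(christoffelAt g u.proj u.snd)) : E →L[ℝ] E × E)

/-- The vector `X` in the decomposition `X^H + Y^V` of a tangent vector at `u`. -/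
def horizontalPart (u : TangentBundle I M) :
    TangentSpace I.tangent u →L[ℝ] TangentSpace I u.proj :=
  (ContinuousLinearMap.fst ℝ E E : E × E →L[ℝ] E)

/-- The vector `Y` in the decomposition `X^H + Y^V` of a tangent vector at `u`. -/
def verticalPart (g : FormField I M) (u : TangentBundle I M) :
    TangentSpace I.tangent u →L[ℝ] TangentSpace I u.proj :=
  (ContinuousLinearMap.snd ℝ E E + christoffelAt g u.proj u.snd ∘L ContinuousLinearMap.fst ℝ E E :
    E × E →L[ℝ] E)

section Lifts

variable (g : FormField I M) (u : TangentBundle I M) (X : TangentSpace I u.proj)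

@[simp] theorem horizontalPart_horizontalLift : horizontalPart u (horizontalLift g u X) = X := rfl

@[simp] theorem horizontalPart_verticalLift : horizontalPart u (verticalLift u X) = 0 := rfl

@[simp] theorem verticalPart_horizontalLift : verticalPart g u (horizontalLift g u X) = 0 :=
  neg_add_cancel (christoffelAt g u.proj u.snd X)

@[simp] theorem verticalPart_verticalLift : verticalPart g u (verticalLift u X) = X := by
  have h : christoffelAt g u.proj u.snd (0 : E) = 0 := map_zero _
  exact (congrArg (fun w : E ↦ (show E from X) + w) h).trans (add_zero (show E from X))

theorem lift_decomposition (ξ : TangentSpace I.tangent u) :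
    horizontalLift g u (horizontalPart u ξ) + verticalLift u (verticalPart g u ξ) = ξ := by
  refine Prod.ext (add_zero ξ.1) ?_
  exact neg_add_cancel_comm_assoc (christoffelAt g u.proj u.snd ξ.1) ξ.2

end Lifts

namespace AlmostSkewHermitian

variable (S : AlmostSkewHermitian I M)

/-- The Sasaki metric on the tangent bundle. -/
def sasaki : FormField I.tangent (TangentBundle I M) := fun u ↦
  ((S.g.val u.proj).bilinearComp
      (show E × E →L[ℝ] E from horizontalPart u) (show E × E →L[ℝ] E from horizontalPart u)
    + (S.g.val u.proj).bilinearComp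
      (show E × E →L[ℝ] E from verticalPart S.g u) (show E × E →L[ℝ] E from verticalPart S.g u) :
    E × E →L[ℝ] E × E →L[ℝ] ℝ)

theorem sasaki_apply (u : TangentBundle I M) (ξ η : TangentSpace I.tangent u) :
    S.sasaki u ξ η = S.g u.proj (horizontalPart u ξ) (horizontalPart u η)
      + S.g u.proj (verticalPart S.g u ξ) (verticalPart S.g u η) := rfl

/-- The almost complex structure `X^H ↦ X^V`, `X^V ↦ -X^H` on the tangent bundle. -/
def J₁ : EndField I.tangent (TangentBundle I M) := fun u ↦
  verticalLift u ∘L horizontalPart u - horizontalLift S.g u ∘L verticalPart S.g u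

/-- The almost complex structure `X^H ↦ (J X)^V`, `X^V ↦ (J X)^H` on the tangent bundle. -/
def J₂ : EndField I.tangent (TangentBundle I M) := fun u ↦
  verticalLift u ∘L S.J u.proj ∘L horizontalPart u
    + horizontalLift S.g u ∘L S.J u.proj ∘L verticalPart S.g u

/-- The almost complex structure `J₁ ∘ J₂` on the tangent bundle. -/
def J₃ : EndField I.tangent (TangentBundle I M) := fun u ↦ S.J₁ u ∘L S.J₂ u

section Check

variable (u : TangentBundle I M) (X Y : TangentSpace I u.proj)

theorem sasaki_horizontal_horizontal :
    S.sasaki u (horizontalLift S.g u X) (horizontalLift S.g u Y) = S.g u.proj X Y := by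
  simp [sasaki_apply]

theorem sasaki_vertical_vertical :
    S.sasaki u (verticalLift u X) (verticalLift u Y) = S.g u.proj X Y := by
  simp [sasaki_apply]

theorem sasaki_horizontal_vertical :
    S.sasaki u (horizontalLift S.g u X) (verticalLift u Y) = 0 := by
  simp [sasaki_apply]

theorem J₁_horizontal : S.J₁ u (horizontalLift S.g u X) = verticalLift u X := by
  simp [J₁]

theorem J₁_vertical : S.J₁ u (verticalLift u X) = -horizontalLift S.g u X := by
  simp [J₁]

theorem J₂_horizontal :
    S.J₂ u (horizontalLift S.g u X) = verticalLift u (S.J u.proj X) := by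
  simp [J₂]

theorem J₂_vertical :
    S.J₂ u (verticalLift u X) = horizontalLift S.g u (S.J u.proj X) := by
  simp [J₂]

end Check

end AlmostSkewHermitian

end TangentBundle

end SkewHermitian

end

/-! Work at `u` in `TM` in the frame of horizontal and vertical lifts. There the Sasaki metric is
two copies of `g`, and each `J_α` is a 2×2 block matrix with entries `0`, `±1` or `±J` depending
only on the base point. In this frame the Levi-Civita connection of the Sasaki metric has three
contributions: the connection of `g` on both components, the derivative of the frame, and terms in
`R(·,·)u` because horizontal lifts do not commute. Since `J₁` is skew-adjoint and `J₂`, `J₃` are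
self-adjoint (`g(JX,Y) = g(X,JY)` follows from the anti-isometry property), the frame derivative
cancels in `∇J_α`. What remains of `F_α` is the covariant derivative of the block matrix plus
curvature terms (`structural_sasakiCoord`).

The contraction over `TM` is the sum of a horizontal and a vertical contraction with `g`
(`metricTrace_prod`). A trace ignores antisymmetric forms, is unchanged by transposing the form, and
lets the self-adjoint `J` pass from one slot to the other. With these rules the curvature terms
cancel for `J₁`, add up to the associated Ricci tensor for `J₂`, and vanish for `J₃`. At `ξ = X^H +
Y^V` this gives `θ₁(ξ) = 0`, `θ₂(ξ) = θ(Y) + ρ̃(X, u)` and `θ₃(ξ) = -θ(X)`, from which the three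
claims are read off by varying `u`, `X`, `Y`.

The computation takes place in the model space. The definitions read the tangent vectors at each
point in that point's own preferred chart, while derivatives need one fixed chart near `u`. The
transformation law of the Christoffel symbols bridges the two: horizontal and vertical parts change
only by the differential of the coordinate change on `M` (`adapted_fderiv_transition`), so in the
fixed chart all fields have the model form (`sasaki_inChart`, `inChart_eq_endCoord`). -/

noncomputable section

namespace SkewHermitian

open scoped Topology

/-! ### Linear algebra of contractions with a nondegenerate symmetric form. -/

section MetricTrace

variable {E : Type*} [NormedAddCommGroup E] [NormedSpace ℝ E]

/-- A nondegenerate symmetric bilinear form. -/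
structure IsMetric (h : E →L[ℝ] E →L[ℝ] ℝ) : Prop where
  symm : ∀ v w, h v w = h w v
  nondegenerate : ∀ v, (∀ w, h v w = 0) → v = 0

namespace IsMetric

variable {h : E →L[ℝ] E →L[ℝ] ℝ}

theorem ext_left (hh : IsMetric h) {v w : E} (H : ∀ z, h v z = h w z) : v = w :=
  sub_eq_zero.1 (hh.nondegenerate _ fun z ↦ by simp [H z])

variable [FiniteDimensional ℝ E]

theorem isInvertible (hh : IsMetric h) : h.IsInvertible := by
  have hinj : Function.Injective (h : E →ₗ[ℝ] E →L[ℝ] ℝ) := fun v w hvw ↦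
    hh.ext_left fun z ↦ congrArg (fun f : E →L[ℝ] ℝ ↦ f z) hvw
  have hdim : Module.finrank ℝ E = Module.finrank ℝ (E →L[ℝ] ℝ) := by
    rw [← LinearEquiv.finrank_eq (LinearMap.toContinuousLinearMap (𝕜 := ℝ) (E := E) (F' := ℝ))]
    exact (Subspace.dual_finrank_eq (K := ℝ) (V := E)).symm
  have hbij : Function.Bijective (h : E →ₗ[ℝ] E →L[ℝ] ℝ) :=
    ⟨hinj, (LinearMap.injective_iff_surjective_of_finrank_eq_finrank hdim).1 hinj⟩
  refine ⟨(LinearEquiv.ofBijective (h : E →ₗ[ℝ] E →L[ℝ] ℝ) hbij).toContinuousLinearEquiv, ?_⟩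
  ext; rfl

theorem apply_inverse (hh : IsMetric h) (φ : E →L[ℝ] ℝ) : h (h.inverse φ) = φ :=
  hh.isInvertible.self_apply_inverse φ

/-- Nondegeneracy makes the operator representing `β` unique, so any explicit representative
computes the contraction without `inverse`. -/
theorem metricTrace_eq (hh : IsMetric h) {β : E →L[ℝ] E →L[ℝ] ℝ} {B : E →ₗ[ℝ] E}
    (hB : ∀ v w, h (B v) w = β v w) : metricTrace h β = LinearMap.trace ℝ E B := by
  unfold metricTrace
  congr 1
  ext v
  refine hh.ext_left fun w ↦ ?_
  rw [hB]
  change h (h.inverse (β v)) w = _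
  rw [hh.apply_inverse]

/-- Transposing `β` replaces its operator by the `h`-adjoint, which is conjugate through `h` to the
dual map and so has the same trace. -/
theorem metricTrace_flip (hh : IsMetric h) (β : E →L[ℝ] E →L[ℝ] ℝ) :
    metricTrace h β.flip = metricTrace h β := by
  let e : E ≃ₗ[ℝ] Module.Dual ℝ E :=
    LinearEquiv.ofBijective
      ((LinearMap.toContinuousLinearMap (𝕜 := ℝ) (E := E) (F' := ℝ)).symm.toLinearMap ∘ₗ
        (h : E →ₗ[ℝ] E →L[ℝ] ℝ))
      ((LinearMap.toContinuousLinearMap (𝕜 := ℝ) (E := E) (F' := ℝ)).symm.bijective.comp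
        hh.isInvertible.bijective)
  have he (v w : E) : e v w = h v w := rfl
  let B : E →ₗ[ℝ] E := ((h.inverse ∘L β : E →L[ℝ] E) : E →ₗ[ℝ] E)
  have hB (v w : E) : h (B v) w = β v w := by
    change h (h.inverse (β v)) w = _
    rw [hh.apply_inverse]
  -- The dual map of `B`, carried back to `E` by `e`, represents the transposed form; symmetry of
  -- `h` enters here.
  have hC : ∀ v w, h ((e.symm.conj (Module.Dual.transpose (R := ℝ) B)) v) w = β.flip v w := by
    intro v w
    rw [← he, LinearEquiv.conj_apply]
    simp only [LinearMap.coe_comp, LinearEquiv.coe_coe, Function.comp_apply, LinearEquiv.symm_symm,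
      LinearEquiv.apply_symm_apply, ContinuousLinearMap.flip_apply]
    rw [← hB w v, hh.symm, ← he]
    rfl
  rw [hh.metricTrace_eq hC, hh.metricTrace_eq hB, LinearMap.trace_conj']
  exact LinearMap.trace_transpose' B

theorem metricTrace_eq_zero_of_antisymm (hh : IsMetric h) {β : E →L[ℝ] E →L[ℝ] ℝ}
    (H : ∀ v w, β v w = -β w v) : metricTrace h β = 0 := by
  have h1 := hh.metricTrace_flip β
  have h2 : β.flip = -β := by ext v w; simp [H w v]
  rw [h2] at h1
  have h3 : metricTrace h (-β) = -metricTrace h β := by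
    unfold metricTrace
    rw [← map_neg]
    congr 1
    ext v
    simp
  linarith

/-- If `B` represents `β`, the two forms are represented by `B ∘ J` and, by self-adjointness, `J ∘
B`; cyclicity of the trace finishes. -/
theorem metricTrace_comp_left_eq_right (hh : IsMetric h) (β : E →L[ℝ] E →L[ℝ] ℝ)
    {J : E →L[ℝ] E} (hJ : ∀ v w, h (J v) w = h v (J w)) {β₁ β₂ : E →L[ℝ] E →L[ℝ] ℝ}
    (h₁ : ∀ v w, β₁ v w = β (J v) w) (h₂ : ∀ v w, β₂ v w = β v (J w)) :
    metricTrace h β₁ = metricTrace h β₂ := by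
  let B : E →ₗ[ℝ] E := ((h.inverse ∘L β : E →L[ℝ] E) : E →ₗ[ℝ] E)
  have hB (v w : E) : h (B v) w = β v w := by
    change h (h.inverse (β v)) w = _
    rw [hh.apply_inverse]
  rw [hh.metricTrace_eq (B := B ∘ₗ J) fun v w ↦ by simp [hB, h₁],
    hh.metricTrace_eq (B := (J : E →ₗ[ℝ] E) ∘ₗ B) fun v w ↦ by simp [hB, hJ, h₂]]
  exact LinearMap.trace_comp_comm' _ _

end IsMetric

/-- Insert the resolution of the identity by the two injections and projections, then use cyclicity
of the trace. -/
theorem trace_prod [FiniteDimensional ℝ E] (C : E × E →ₗ[ℝ] E × E) :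
    LinearMap.trace ℝ (E × E) C =
      LinearMap.trace ℝ E (LinearMap.fst ℝ E E ∘ₗ C ∘ₗ LinearMap.inl ℝ E E)
        + LinearMap.trace ℝ E (LinearMap.snd ℝ E E ∘ₗ C ∘ₗ LinearMap.inr ℝ E E) := by
  have hC : C = LinearMap.inl ℝ E E ∘ₗ (LinearMap.fst ℝ E E ∘ₗ C)
      + LinearMap.inr ℝ E E ∘ₗ (LinearMap.snd ℝ E E ∘ₗ C) := by
    ext <;> simp
  conv_lhs => rw [hC, map_add, LinearMap.trace_comp_comm' _ (LinearMap.inl ℝ E E),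
    LinearMap.trace_comp_comm' _ (LinearMap.inr ℝ E E)]
  rfl

/-- The contraction with a metric on `E × E` which is the orthogonal sum of two copies of `h` in a
suitable frame. -/
theorem metricTrace_prod [FiniteDimensional ℝ E] {h : E →L[ℝ] E →L[ℝ] ℝ} (hh : IsMetric h)
    {G β : E × E →L[ℝ] E × E →L[ℝ] ℝ} (hG : IsMetric G) (Q : (E × E) ≃L[ℝ] (E × E))
    (hGQ : ∀ ξ η, G ξ η = h (Q ξ).1 (Q η).1 + h (Q ξ).2 (Q η).2)
    {β₁ β₂ : E →L[ℝ] E →L[ℝ] ℝ} (h₁ : ∀ v w, β (Q.symm (v, 0)) (Q.symm (w, 0)) = β₁ v w)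
    (h₂ : ∀ v w, β (Q.symm (0, v)) (Q.symm (0, w)) = β₂ v w) :
    metricTrace G β = metricTrace h β₁ + metricTrace h β₂ := by
  let B : E × E →ₗ[ℝ] E × E := ((G.inverse ∘L β : E × E →L[ℝ] E × E) : E × E →ₗ[ℝ] E × E)
  have hB (v w : E × E) : G (B v) w = β v w := by
    change G (G.inverse (β v)) w = _
    rw [hG.apply_inverse]
  let C := Q.toLinearEquiv.conj B
  have hC (v w : E × E) : h (C v).1 w.1 + h (C v).2 w.2 = β (Q.symm v) (Q.symm w) := by
    rw [← hB, hGQ]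
    simp [C, LinearEquiv.conj_apply]
  rw [hG.metricTrace_eq hB, ← LinearMap.trace_conj' B Q.toLinearEquiv, trace_prod,
    hh.metricTrace_eq (B := LinearMap.fst ℝ E E ∘ₗ C ∘ₗ LinearMap.inl ℝ E E),
    hh.metricTrace_eq (B := LinearMap.snd ℝ E E ∘ₗ C ∘ₗ LinearMap.inr ℝ E E)]
  · intro v w
    simpa [h₂] using hC (0, v) (0, w)
  · intro v w
    simpa [h₁] using hC (v, 0) (w, 0)

end MetricTrace

/-! ### Levi-Civita connection and Lie form in coordinates. -/

section Local

variable {E : Type*} [NormedAddCommGroup E] [NormedSpace ℝ E]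

/-- The Christoffel symbols of the metric with components `g`. -/
def localChristoffel (g : E → E →L[ℝ] E →L[ℝ] ℝ) (x : E) : E →L[ℝ] E →L[ℝ] E :=
  ContinuousLinearMap.compL ℝ E (E →L[ℝ] ℝ) E (g x).inverse ∘L christoffelFirst (fderiv ℝ g x)

/-- The covariant derivative of the endomorphism field with components `J`, for a connection with
Christoffel symbols `Γ` at `x`. -/
def localNabla (Γ : E →L[ℝ] E →L[ℝ] E) (J : E → E →L[ℝ] E) (x : E) : E →L[ℝ] E →L[ℝ] E :=
  fderiv ℝ J x + (ContinuousLinearMap.compL ℝ E E E).flip (J x) ∘L Γ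
    - ContinuousLinearMap.compL ℝ E E E (J x) ∘L Γ

theorem localNabla_apply (Γ : E →L[ℝ] E →L[ℝ] E) (J : E → E →L[ℝ] E) (x v w : E) :
    localNabla Γ J x v w = fderiv ℝ J x v w + Γ v (J x w) - J x (Γ v w) := by
  simp [localNabla]

/-- The Lie form of an endomorphism field with components `J`, for the metric with
components `g`. -/
def localLieForm (g : E → E →L[ℝ] E →L[ℝ] ℝ) (J : E → E →L[ℝ] E) (x z : E) : ℝ :=
  metricTrace (g x) (ContinuousLinearMap.compL ℝ E E ℝ ((g x).flip z) ∘L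
    localNabla (localChristoffel g x) J x)

theorem localChristoffel_congr {g g' : E → E →L[ℝ] E →L[ℝ] ℝ} {x : E} (h : g =ᶠ[𝓝 x] g') :
    localChristoffel g x = localChristoffel g' x := by
  rw [localChristoffel, localChristoffel, h.eq_of_nhds, h.fderiv_eq]

/-- Only the values and first derivatives at `x` enter, so the components need to be known only near
the point. -/
theorem localLieForm_congr {g g' : E → E →L[ℝ] E →L[ℝ] ℝ} {J J' : E → E →L[ℝ] E} {x : E}
    (h : g =ᶠ[𝓝 x] g') (hJ : J =ᶠ[𝓝 x] J') (z : E) :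
    localLieForm g J x z = localLieForm g' J' x z := by
  rw [localLieForm, localLieForm, localChristoffel_congr h, h.eq_of_nhds, localNabla, localNabla,
    hJ.eq_of_nhds, hJ.fderiv_eq]

theorem fderiv_clm_apply_const {F F' : Type*} [NormedAddCommGroup F] [NormedSpace ℝ F]
    [NormedAddCommGroup F'] [NormedSpace ℝ F'] {c : E → F →L[ℝ] F'} {x : E}
    (hc : DifferentiableAt ℝ c x) (v : E) (w : F) :
    fderiv ℝ (fun y ↦ c y w) x v = fderiv ℝ c x v w := by
  rw [fderiv_clm_apply hc (differentiableAt_const w)]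
  simp

theorem fderiv_symm_of_eventually {F F' : Type*} [NormedAddCommGroup F] [NormedSpace ℝ F]
    [NormedAddCommGroup F'] [NormedSpace ℝ F'] {g : E → F →L[ℝ] F →L[ℝ] F'} {x : E}
    (hg : DifferentiableAt ℝ g x) (hs : ∀ᶠ y in 𝓝 x, ∀ v w, g y v w = g y w v) (v : E)
    (a b : F) : fderiv ℝ g x v a b = fderiv ℝ g x v b a := by
  rw [← fderiv_clm_apply_const hg, ← fderiv_clm_apply_const hg,
    ← fderiv_clm_apply_const (by fun_prop), ← fderiv_clm_apply_const (by fun_prop)]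
  have : (fun y ↦ g y a b) =ᶠ[𝓝 x] fun y ↦ g y b a := hs.mono fun y hy ↦ hy a b
  rw [this.fderiv_eq]

variable [FiniteDimensional ℝ E] {g : E → E →L[ℝ] E →L[ℝ] ℝ} {x : E}

theorem localChristoffel_spec (hm : IsMetric (g x)) (v w z : E) :
    g x (localChristoffel g x v w) z =
      1 / 2 * (fderiv ℝ g x v w z + fderiv ℝ g x w v z - fderiv ℝ g x z v w) := by
  rw [← christoffelFirst_apply]
  change g x ((g x).inverse (christoffelFirst (fderiv ℝ g x) v w)) z = _
  rw [hm.apply_inverse]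

theorem localChristoffel_symm (hg : DifferentiableAt ℝ g x) (hm : ∀ᶠ y in 𝓝 x, IsMetric (g y))
    (v w : E) : localChristoffel g x v w = localChristoffel g x w v := by
  refine hm.self_of_nhds.ext_left fun z ↦ ?_
  rw [localChristoffel_spec hm.self_of_nhds, localChristoffel_spec hm.self_of_nhds,
    fderiv_symm_of_eventually hg (hm.mono fun y hy ↦ hy.symm) z v w]
  ring

/-- Metric compatibility `∇g = 0`, from adding two Koszul formulas. -/
theorem fderiv_metric_eq (hg : DifferentiableAt ℝ g x) (hm : ∀ᶠ y in 𝓝 x, IsMetric (g y))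
    (v a b : E) : fderiv ℝ g x v a b =
      g x (localChristoffel g x v a) b + g x a (localChristoffel g x v b) := by
  have hs := fderiv_symm_of_eventually hg (hm.mono fun y hy ↦ hy.symm)
  rw [hm.self_of_nhds.symm a, localChristoffel_spec hm.self_of_nhds,
    localChristoffel_spec hm.self_of_nhds, hs v b a]
  ring

set_option synthInstance.maxHeartbeats 400000 in
theorem contDiffAt_localChristoffel {n m : WithTop ℕ∞} (hg : ContDiffAt ℝ n g x)
    (hm : IsMetric (g x)) (hmn : m + 1 ≤ n) : ContDiffAt ℝ m (localChristoffel g) x := by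
  have h1 : ContDiffAt ℝ m (fderiv ℝ g) x := hg.fderiv_right hmn
  have h2 : ContDiffAt ℝ m (fun y ↦ (g y).inverse) x := by
    have h3 : ContDiffAt ℝ m (ContinuousLinearMap.inverse (R := ℝ) (M := E) (M₂ := E →L[ℝ] ℝ))
      (g x) := hm.isInvertible.contDiffAt_map_inverse
    exact h3.comp x (hg.of_le (le_trans le_self_add hmn))
  have h4 : ContDiffAt ℝ m (fun y ↦ christoffelFirst (fderiv ℝ g y)) x := by
    have h5 : ContDiffAt ℝ m (fun y ↦ (fderiv ℝ g y).flip) x :=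
      (ContinuousLinearMap.flipₗᵢ ℝ E E (E →L[ℝ] ℝ)).contDiff.contDiffAt.comp x h1
    exact ((h1.add h5).sub (contDiffAt_const.clm_comp h5)).const_smul _
  exact ((ContinuousLinearMap.compL ℝ E (E →L[ℝ] ℝ) E).contDiff.contDiffAt.comp x h2).clm_comp h4

end Local

/-! ### The adapted frame on the tangent bundle in induced coordinates. -/

section AdaptedFrame

variable {E : Type*} [NormedAddCommGroup E] [NormedSpace ℝ E]

/-- The orthogonal sum of two copies of a bilinear form. -/
def sumForm (h : E →L[ℝ] E →L[ℝ] ℝ) : E × E →L[ℝ] E × E →L[ℝ] ℝ :=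
  h.bilinearComp (ContinuousLinearMap.fst ℝ E E) (ContinuousLinearMap.fst ℝ E E)
    + h.bilinearComp (ContinuousLinearMap.snd ℝ E E) (ContinuousLinearMap.snd ℝ E E)

theorem sumForm_apply (h : E →L[ℝ] E →L[ℝ] ℝ) (a b : E × E) :
    sumForm h a b = h a.1 b.1 + h a.2 b.2 := rfl

/-- The horizontal and vertical parts of a vector at `X = (x, y)` in induced coordinates. -/
def adapted (Γ : E → E →L[ℝ] E →L[ℝ] E) (X : E × E) : (E × E) →L[ℝ] (E × E) :=
  (ContinuousLinearMap.fst ℝ E E).prod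
    (ContinuousLinearMap.snd ℝ E E + Γ X.1 X.2 ∘L ContinuousLinearMap.fst ℝ E E)

/-- The inverse of `adapted`: the sum of a horizontal and a vertical lift. -/
def adaptedSymm (Γ : E → E →L[ℝ] E →L[ℝ] E) (X : E × E) : (E × E) →L[ℝ] (E × E) :=
  (ContinuousLinearMap.fst ℝ E E).prod
    (ContinuousLinearMap.snd ℝ E E - Γ X.1 X.2 ∘L ContinuousLinearMap.fst ℝ E E)

variable (Γ : E → E →L[ℝ] E →L[ℝ] E) (X : E × E)

theorem adapted_apply (ξ : E × E) : adapted Γ X ξ = (ξ.1, ξ.2 + Γ X.1 X.2 ξ.1) := rfl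

theorem adaptedSymm_apply (ξ : E × E) : adaptedSymm Γ X ξ = (ξ.1, ξ.2 - Γ X.1 X.2 ξ.1) := rfl

@[simp] theorem adapted_adaptedSymm (ξ : E × E) : adapted Γ X (adaptedSymm Γ X ξ) = ξ := by
  simp [adapted_apply, adaptedSymm_apply]

@[simp] theorem adaptedSymm_adapted (ξ : E × E) : adaptedSymm Γ X (adapted Γ X ξ) = ξ := by
  simp [adapted_apply, adaptedSymm_apply]

/-- `adapted` as an equivalence. -/
def adaptedEquiv : (E × E) ≃L[ℝ] (E × E) :=
  ContinuousLinearEquiv.equivOfInverse (adapted Γ X) (adaptedSymm Γ X)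
    (adaptedSymm_adapted Γ X) (adapted_adaptedSymm Γ X)

/-- The components of the Sasaki metric in induced coordinates. -/
def sasakiCoord (g : E → E →L[ℝ] E →L[ℝ] ℝ) : E × E →L[ℝ] E × E →L[ℝ] ℝ :=
  (sumForm (g X.1)).bilinearComp (adapted Γ X) (adapted Γ X)

/-- The components in induced coordinates of the endomorphism field given by `k` in the adapted
frame. -/
def endCoord (k : E → E × E →L[ℝ] E × E) : E × E →L[ℝ] E × E :=
  adaptedSymm Γ X ∘L k X.1 ∘L adapted Γ X

theorem sasakiCoord_apply (g : E → E →L[ℝ] E →L[ℝ] ℝ) (ξ η : E × E) :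
    sasakiCoord Γ X g ξ η = sumForm (g X.1) (adapted Γ X ξ) (adapted Γ X η) := rfl

theorem adapted_endCoord (k : E → E × E →L[ℝ] E × E) (ξ : E × E) :
    adapted Γ X (endCoord Γ X k ξ) = k X.1 (adapted Γ X ξ) := by
  simp [endCoord]

theorem IsMetric.sasakiCoord {g : E → E →L[ℝ] E →L[ℝ] ℝ} (hg : IsMetric (g X.1)) :
    IsMetric (sasakiCoord Γ X g) where
  symm ξ η := by simp [sasakiCoord_apply, sumForm_apply, hg.symm]
  nondegenerate ξ H := by
    have H' (a : E × E) : sumForm (g X.1) (adapted Γ X ξ) a = 0 := by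
      simpa [sasakiCoord_apply] using H (adaptedSymm Γ X a)
    have h1 := hg.nondegenerate (adapted Γ X ξ).1 fun w ↦ by simpa [sumForm_apply] using H' (w, 0)
    have h2 := hg.nondegenerate (adapted Γ X ξ).2 fun w ↦ by simpa [sumForm_apply] using H' (0, w)
    rw [← adaptedSymm_adapted Γ X ξ, Prod.ext (x := adapted Γ X ξ) (y := 0) h1 h2, map_zero]

end AdaptedFrame

/-! ### Derivatives of the adapted frame and of fields given in it. -/

section Derivatives

variable {E : Type*} [NormedAddCommGroup E] [NormedSpace ℝ E]
  {Γ : E → E →L[ℝ] E →L[ℝ] E} {X : E × E}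

/-- The vertical component of the derivative of `adapted`. -/
def adaptedDeriv (Γ : E → E →L[ℝ] E →L[ℝ] E) (X ξ η : E × E) : E :=
  fderiv ℝ Γ X.1 ξ.1 X.2 η.1 + Γ X.1 ξ.2 η.1

theorem differentiableAt_adapted (hΓ : DifferentiableAt ℝ Γ X.1) :
    DifferentiableAt ℝ (adapted Γ) X := by
  have h1 : DifferentiableAt ℝ (fun Y : E × E ↦ Γ Y.1) X := hΓ.comp X differentiableAt_fst
  have h2 : DifferentiableAt ℝ (fun Y : E × E ↦ Γ Y.1 Y.2) X := h1.clm_apply differentiableAt_snd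
  have h3 : adapted Γ = fun Y ↦ ContinuousLinearMap.id ℝ (E × E) +
      ContinuousLinearMap.inr ℝ E E ∘L Γ Y.1 Y.2 ∘L ContinuousLinearMap.fst ℝ E E := by
    ext Y ξ <;> simp [adapted_apply]
  rw [h3]
  fun_prop

theorem differentiableAt_adaptedSymm (hΓ : DifferentiableAt ℝ Γ X.1) :
    DifferentiableAt ℝ (adaptedSymm Γ) X := by
  have h1 : DifferentiableAt ℝ (fun Y : E × E ↦ Γ Y.1) X := hΓ.comp X differentiableAt_fst
  have h2 : DifferentiableAt ℝ (fun Y : E × E ↦ Γ Y.1 Y.2) X := h1.clm_apply differentiableAt_snd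
  have h3 : adaptedSymm Γ = fun Y ↦ ContinuousLinearMap.id ℝ (E × E) -
      ContinuousLinearMap.inr ℝ E E ∘L Γ Y.1 Y.2 ∘L ContinuousLinearMap.fst ℝ E E := by
    ext Y ξ <;> simp [adaptedSymm_apply]
  rw [h3]
  fun_prop

/-- The horizontal part does not depend on the base point `X`, so only the vertical component
varies. -/
theorem fderiv_adapted (hΓ : DifferentiableAt ℝ Γ X.1) (ξ η : E × E) :
    fderiv ℝ (adapted Γ) X ξ η = (0, adaptedDeriv Γ X ξ η) := by
  have h1 : HasFDerivAt (fun Y : E × E ↦ Γ Y.1)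
      (fderiv ℝ Γ X.1 ∘L ContinuousLinearMap.fst ℝ E E) X :=
    hΓ.hasFDerivAt.comp X hasFDerivAt_fst
  have h2 := ((h1.clm_apply hasFDerivAt_snd).clm_apply (hasFDerivAt_const η.1 X)).const_add η.2
  have h3 := (hasFDerivAt_const η.1 X).prodMk h2
  rw [← fderiv_clm_apply_const (differentiableAt_adapted hΓ)]
  change fderiv ℝ (fun Y : E × E ↦ (η.1, η.2 + Γ Y.1 Y.2 η.1)) X ξ = _
  rw [h3.fderiv]
  simp [adaptedDeriv, add_comm]

variable {g : E → E →L[ℝ] E →L[ℝ] ℝ} {k : E → E × E →L[ℝ] E × E}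

theorem DifferentiableAt.bilinearComp {F G : Type*} [NormedAddCommGroup F] [NormedSpace ℝ F]
    [NormedAddCommGroup G] [NormedSpace ℝ G]
    {h : F → E →L[ℝ] E →L[ℝ] ℝ} {a : F → G →L[ℝ] E} {y : F} (hh : DifferentiableAt ℝ h y)
    (ha : DifferentiableAt ℝ a y) :
    DifferentiableAt ℝ (fun z ↦ (h z).bilinearComp (a z) (a z)) y := by
  have h1 : DifferentiableAt ℝ (fun z ↦ (h z ∘L a z).flip) y :=
    (ContinuousLinearMap.flipₗᵢ ℝ G E ℝ).toContinuousLinearEquiv.differentiableAt.comp y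
      (hh.clm_comp ha)
  exact (ContinuousLinearMap.flipₗᵢ ℝ G G ℝ).toContinuousLinearEquiv.differentiableAt.comp y
    (h1.clm_comp ha)

theorem differentiableAt_sasakiCoord (hΓ : DifferentiableAt ℝ Γ X.1)
    (hg : DifferentiableAt ℝ g X.1) : DifferentiableAt ℝ (fun Y ↦ sasakiCoord Γ Y g) X := by
  have h1 : DifferentiableAt ℝ (fun Y : E × E ↦ g Y.1) X := hg.comp X differentiableAt_fst
  exact DifferentiableAt.bilinearComp
    ((DifferentiableAt.bilinearComp h1 (differentiableAt_const _)).add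
      (DifferentiableAt.bilinearComp h1 (differentiableAt_const _))) (differentiableAt_adapted hΓ)

theorem differentiableAt_endCoord (hΓ : DifferentiableAt ℝ Γ X.1)
    (hk : DifferentiableAt ℝ k X.1) : DifferentiableAt ℝ (fun Y ↦ endCoord Γ Y k) X := by
  have h1 : DifferentiableAt ℝ (fun Y : E × E ↦ k Y.1) X := hk.comp X differentiableAt_fst
  exact (differentiableAt_adaptedSymm hΓ).clm_comp (h1.clm_comp (differentiableAt_adapted hΓ))

theorem fderiv_sasakiCoord (hΓ : DifferentiableAt ℝ Γ X.1) (hg : DifferentiableAt ℝ g X.1)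
    (ξ η ζ : E × E) :
    fderiv ℝ (fun Y ↦ sasakiCoord Γ Y g) X ξ η ζ =
      sumForm (fderiv ℝ g X.1 ξ.1) (adapted Γ X η) (adapted Γ X ζ)
        + g X.1 (adaptedDeriv Γ X ξ η) (adapted Γ X ζ).2
        + g X.1 (adapted Γ X η).2 (adaptedDeriv Γ X ξ ζ) := by
  have hG := differentiableAt_sasakiCoord hΓ hg
  have hd (η : E × E) : HasFDerivAt (fun Y ↦ adapted Γ Y η) ((fderiv ℝ (adapted Γ) X).flip η) X := by
    have := (differentiableAt_adapted hΓ).hasFDerivAt.clm_apply (hasFDerivAt_const η X)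
    simpa using this
  have hgX : HasFDerivAt (fun Y : E × E ↦ g Y.1)
      (fderiv ℝ g X.1 ∘L ContinuousLinearMap.fst ℝ E E) X :=
    hg.hasFDerivAt.comp X hasFDerivAt_fst
  rw [← fderiv_clm_apply_const hG, ← fderiv_clm_apply_const (by fun_prop)]
  have h := ((hgX.clm_apply (hd η).fst).clm_apply (hd ζ).fst).add
    ((hgX.clm_apply (hd η).snd).clm_apply (hd ζ).snd)
  change fderiv ℝ (fun Y : E × E ↦ g Y.1 (adapted Γ Y η).1 (adapted Γ Y ζ).1
    + g Y.1 (adapted Γ Y η).2 (adapted Γ Y ζ).2) X ξ = _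
  erw [h.fderiv]
  simp [fderiv_adapted hΓ, sumForm_apply]
  ring

theorem adapted_fderiv_endCoord (hΓ : DifferentiableAt ℝ Γ X.1) (hk : DifferentiableAt ℝ k X.1)
    (ξ η : E × E) :
    adapted Γ X (fderiv ℝ (fun Y ↦ endCoord Γ Y k) X ξ η) =
      fderiv ℝ k X.1 ξ.1 (adapted Γ X η) + k X.1 (0, adaptedDeriv Γ X ξ η)
        - (0, adaptedDeriv Γ X ξ (endCoord Γ X k η)) := by
  have hK := differentiableAt_endCoord hΓ hk
  have hQ := (differentiableAt_adapted hΓ).hasFDerivAt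
  have hkX : HasFDerivAt (fun Y : E × E ↦ k Y.1)
      (fderiv ℝ k X.1 ∘L ContinuousLinearMap.fst ℝ E E) X :=
    hk.hasFDerivAt.comp X hasFDerivAt_fst
  have h1 := hQ.clm_apply (hK.hasFDerivAt.clm_apply (hasFDerivAt_const η X))
  have h2 := hkX.clm_apply (hQ.clm_apply (hasFDerivAt_const η X))
  -- Differentiating this intertwining relation in two ways avoids the derivative of the inverse
  -- frame.
  have h3 : (fun Y ↦ adapted Γ Y (endCoord Γ Y k η)) = fun Y ↦ k Y.1 (adapted Γ Y η) := by
    ext1 Y; exact adapted_endCoord Γ Y k η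
  rw [h3] at h1
  have h4 := congrArg (fun f ↦ f ξ) (h1.unique h2)
  simp [fderiv_adapted hΓ] at h4
  rw [eq_sub_iff_add_eq, h4, add_comm]

end Derivatives

/-! ### Connection of the Sasaki metric and the structural tensor. -/

section Structural

variable {E : Type*} [NormedAddCommGroup E] [NormedSpace ℝ E]

/-- The curvature of the connection with Christoffel symbols `Γ`. -/
def localCurvature (Γ : E → E →L[ℝ] E →L[ℝ] E) (x a b c : E) : E :=
  fderiv ℝ Γ x a b c - fderiv ℝ Γ x b a c + Γ x a (Γ x b c) - Γ x b (Γ x a c)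

theorem localCurvature_antisymm (Γ : E → E →L[ℝ] E →L[ℝ] E) (x a b c : E) :
    localCurvature Γ x a b c = -localCurvature Γ x b a c := by
  simp only [localCurvature]; abel

@[simp] theorem localCurvature_zero (Γ : E → E →L[ℝ] E →L[ℝ] E) (x a c : E) :
    localCurvature Γ x a 0 c = 0 := by
  simp [localCurvature]

/-- The contribution of the curvature to the Christoffel symbols of the Sasaki metric, for vectors
given by their horizontal and vertical parts. -/
def curvatureTerm (h : E →L[ℝ] E →L[ℝ] ℝ) (R : E → E → E) (a b c : E × E) : ℝ :=
  1 / 2 * (h (R a.1 c.1) b.2 + h (R b.1 c.1) a.2 - h (R a.1 b.1) c.2)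

/-- The structure equation for the vertical coframe, and the source of all curvature terms: its
exterior derivative records that the bracket of horizontal lifts has a vertical part given by
`R(·,·)y`. -/
theorem adaptedDeriv_sub_swap {Γ : E → E →L[ℝ] E →L[ℝ] E} {X : E × E}
    (hs : ∀ v w, Γ X.1 v w = Γ X.1 w v)
    (hs' : ∀ v a b, fderiv ℝ Γ X.1 v a b = fderiv ℝ Γ X.1 v b a) (ξ η : E × E) :
    adaptedDeriv Γ X ξ η - adaptedDeriv Γ X η ξ =
      localCurvature Γ X.1 ξ.1 η.1 X.2 + Γ X.1 (adapted Γ X ξ).2 η.1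
        - Γ X.1 (adapted Γ X η).2 ξ.1 := by
  simp only [adaptedDeriv, localCurvature, adapted_apply, map_add, add_apply]
  rw [hs' ξ.1 X.2, hs' η.1 X.2, hs (Γ X.1 X.2 ξ.1), hs (Γ X.1 X.2 η.1), hs X.2, hs X.2]
  abel

variable [FiniteDimensional ℝ E] {g : E → E →L[ℝ] E →L[ℝ] ℝ} {x y : E}

/-- Put the derivative of the Sasaki metric into the Koszul formula. The structure equation, applied
to each of the three pairs of arguments, leaves one frame-derivative term and turns the rest into
`Γ` and curvature. -/
theorem christoffelFirst_sasakiCoord (hg : DifferentiableAt ℝ g x)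
    (hm : ∀ᶠ z in 𝓝 x, IsMetric (g z)) (hΓ : DifferentiableAt ℝ (localChristoffel g) x)
    (hs' : ∀ v a b, fderiv ℝ (localChristoffel g) x v a b = fderiv ℝ (localChristoffel g) x v b a)
    (ξ η ζ : E × E) :
    christoffelFirst (fderiv ℝ (fun Y ↦ sasakiCoord (localChristoffel g) Y g) (x, y)) ξ η ζ =
      g x (adaptedDeriv (localChristoffel g) (x, y) ξ η)
          (adapted (localChristoffel g) (x, y) ζ).2
        + g x (localChristoffel g x ξ.1 η.1) ζ.1
        + g x (localChristoffel g x ξ.1 (adapted (localChristoffel g) (x, y) η).2)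
          (adapted (localChristoffel g) (x, y) ζ).2
        + curvatureTerm (g x) (fun a b ↦ localCurvature (localChristoffel g) x a b y)
          (adapted (localChristoffel g) (x, y) ξ) (adapted (localChristoffel g) (x, y) η)
          (adapted (localChristoffel g) (x, y) ζ) := by
  have hsymm := hm.self_of_nhds.symm
  have hΓs := localChristoffel_symm hg hm
  have hT := adaptedDeriv_sub_swap (X := (x, y)) hΓs hs'
  have e1 := congrArg (fun v ↦ g x v (adapted (localChristoffel g) (x, y) ζ).2) (hT ξ η)
  have e2 := congrArg (fun v ↦ g x v (adapted (localChristoffel g) (x, y) η).2) (hT ξ ζ)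
  have e3 := congrArg (fun v ↦ g x v (adapted (localChristoffel g) (x, y) ξ).2) (hT η ζ)
  rw [christoffelFirst_apply, fderiv_sasakiCoord (X := (x, y)) hΓ hg,
    fderiv_sasakiCoord (X := (x, y)) hΓ hg, fderiv_sasakiCoord (X := (x, y)) hΓ hg]
  simp only [map_sub, map_add, sub_apply, add_apply]
    at e1 e2 e3
  have f (a : E × E) : (adapted (localChristoffel g) (x, y) a).1 = a.1 := rfl
  simp only [sumForm_apply, fderiv_metric_eq hg hm, curvatureTerm, f]
  rw [hsymm (adapted (localChristoffel g) (x, y) ξ).2 (adaptedDeriv _ _ η ζ),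
    hsymm (adapted (localChristoffel g) (x, y) η).2 (adaptedDeriv _ _ ξ ζ),
    hsymm (adapted (localChristoffel g) (x, y) ξ).2 (adaptedDeriv _ _ ζ η)]
  rw [hsymm (adapted (localChristoffel g) (x, y) η).2 (localChristoffel g x ξ.1 _),
    hsymm (adapted (localChristoffel g) (x, y) ξ).2 (localChristoffel g x η.1 _),
    hsymm (adapted (localChristoffel g) (x, y) ξ).2 (localChristoffel g x ζ.1 _),
    hsymm η.1 (localChristoffel g x ξ.1 _), hsymm ξ.1 (localChristoffel g x η.1 _),
    hsymm ξ.1 (localChristoffel g x ζ.1 _), hΓs η.1 ξ.1, hΓs ζ.1 ξ.1, hΓs ζ.1 η.1]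
  rw [hΓs (adapted (localChristoffel g) (x, y) ξ).2, hΓs (adapted (localChristoffel g) (x, y) η).2]
    at e1
  rw [hΓs (adapted (localChristoffel g) (x, y) ξ).2, hΓs (adapted (localChristoffel g) (x, y) ζ).2]
    at e2
  rw [hΓs (adapted (localChristoffel g) (x, y) η).2, hΓs (adapted (localChristoffel g) (x, y) ζ).2]
    at e3
  linear_combination (-1 / 2) * e1 + (1 / 2) * e2 + (1 / 2) * e3

/-- The action of a connection on `E × E`, componentwise. -/
def diagChristoffel (Γ : E →L[ℝ] E →L[ℝ] E) (v : E) (a : E × E) : E × E := (Γ v a.1, Γ v a.2)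

/-- The sign `ε` moves `K` in `K(Γ(ξ,η))` onto the third argument, so both connection terms are
given by the preceding formula. Their frame-derivative parts cancel those in the derivative of `K`.
-/
theorem structural_sasakiCoord (hg : DifferentiableAt ℝ g x)
    (hm : ∀ᶠ z in 𝓝 x, IsMetric (g z)) (hΓ : DifferentiableAt ℝ (localChristoffel g) x)
    (hs' : ∀ v a b, fderiv ℝ (localChristoffel g) x v a b = fderiv ℝ (localChristoffel g) x v b a)
    {k : E → E × E →L[ℝ] E × E} (hk : DifferentiableAt ℝ k x) {ε : ℝ}
    (hε : ∀ a b, sumForm (g x) (k x a) b = ε * sumForm (g x) a (k x b)) (a b c : E × E) :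
    sasakiCoord (localChristoffel g) (x, y) g
        (localNabla (localChristoffel (fun Y ↦ sasakiCoord (localChristoffel g) Y g) (x, y))
          (fun Y ↦ endCoord (localChristoffel g) Y k) (x, y)
          (adaptedSymm (localChristoffel g) (x, y) a)
          (adaptedSymm (localChristoffel g) (x, y) b))
        (adaptedSymm (localChristoffel g) (x, y) c) =
      sumForm (g x) (fderiv ℝ k x a.1 b + diagChristoffel (localChristoffel g x) a.1 (k x b)
          - k x (diagChristoffel (localChristoffel g x) a.1 b)) c
        + curvatureTerm (g x) (fun a b ↦ localCurvature (localChristoffel g) x a b y) a (k x b) c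
        - ε * curvatureTerm (g x) (fun a b ↦ localCurvature (localChristoffel g) x a b y)
          a b (k x c) := by
  set Γ := localChristoffel g with hΓdef
  set G := fun Y ↦ sasakiCoord Γ Y g with hG
  set K := fun Y ↦ endCoord Γ Y k with hK
  have hGm : IsMetric (G (x, y)) := IsMetric.sasakiCoord Γ (x, y) hm.self_of_nhds
  have hKε (ξ η : E × E) : G (x, y) (K (x, y) ξ) η = ε * G (x, y) ξ (K (x, y) η) := by
    simp only [hG, hK, sasakiCoord_apply, adapted_endCoord, hε]
  set ξ := adaptedSymm Γ (x, y) a with hξ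
  set η := adaptedSymm Γ (x, y) b with hη
  set ζ := adaptedSymm Γ (x, y) c with hζ
  have hKη : adapted Γ (x, y) (K (x, y) η) = k x b := by
    simp only [hK, adapted_endCoord, hη, adapted_adaptedSymm]
  have hKζ : adapted Γ (x, y) (K (x, y) ζ) = k x c := by
    simp only [hK, adapted_endCoord, hζ, adapted_adaptedSymm]
  have h1 : ξ.1 = a.1 := rfl
  have h2 : η.1 = b.1 := rfl
  have h3 : ζ.1 = c.1 := rfl
  have h4 : (K (x, y) η).1 = (k x b).1 := by
    have := congrArg Prod.fst hKη
    exact this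
  have h5 : (K (x, y) ζ).1 = (k x c).1 := by
    have := congrArg Prod.fst hKζ
    exact this
  change G (x, y) _ _ = _
  rw [localNabla_apply, map_sub, map_add, sub_apply,
    add_apply, hKε]
  rw [localChristoffel_spec hGm, localChristoffel_spec hGm, ← christoffelFirst_apply,
    ← christoffelFirst_apply, christoffelFirst_sasakiCoord hg hm hΓ hs',
    christoffelFirst_sasakiCoord hg hm hΓ hs']
  rw [hKη, hKζ, h1, h2, h3, h4, h5]
  have hD : G (x, y) (fderiv ℝ K (x, y) ξ η) ζ = _ := sasakiCoord_apply Γ (x, y) g _ _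
  rw [hD, adapted_fderiv_endCoord (X := (x, y)) hΓ hk]
  simp only [← hΓdef, hξ, hη, hζ, adapted_adaptedSymm]
  rw [show endCoord Γ (x, y) k η = K (x, y) η from rfl, h1]
  simp only [map_add, map_sub, add_apply, sub_apply, hε]
  simp only [sumForm_apply, diagChristoffel]
  simp
  ring

end Structural

/-! ### Lie forms of the three structures in the model space. -/

section LieForms

variable {E : Type*} [NormedAddCommGroup E] [NormedSpace ℝ E]

theorem metricTrace_add (h β γ : E →L[ℝ] E →L[ℝ] ℝ) :
    metricTrace h (β + γ) = metricTrace h β + metricTrace h γ := by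
  simp [metricTrace, ContinuousLinearMap.comp_add]

theorem metricTrace_smul (h β : E →L[ℝ] E →L[ℝ] ℝ) (c : ℝ) :
    metricTrace h (c • β) = c * metricTrace h β := by
  simp [metricTrace]

/-- The curvature `(a, b) ↦ R(a, b) c` as a continuous bilinear map. -/
def curvatureBilin (Γ : E → E →L[ℝ] E →L[ℝ] E) (x c : E) : E →L[ℝ] E →L[ℝ] E :=
  ((ContinuousLinearMap.flipₗᵢ ℝ E E E : (E →L[ℝ] E →L[ℝ] E) →L[ℝ] E →L[ℝ] E →L[ℝ] E)
      ∘L fderiv ℝ Γ x).flip c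
    - (((ContinuousLinearMap.flipₗᵢ ℝ E E E : (E →L[ℝ] E →L[ℝ] E) →L[ℝ] E →L[ℝ] E →L[ℝ] E)
      ∘L fderiv ℝ Γ x).flip c).flip
    + (Γ x).bilinearComp (ContinuousLinearMap.id ℝ E) ((Γ x).flip c)
    - ((Γ x).bilinearComp (ContinuousLinearMap.id ℝ E) ((Γ x).flip c)).flip

theorem curvatureBilin_apply (Γ : E → E →L[ℝ] E →L[ℝ] E) (x a b c : E) :
    curvatureBilin Γ x c a b = localCurvature Γ x a b c := by
  simp [curvatureBilin, localCurvature]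

/-- The associated Ricci tensor of the metric with components `g` and the endomorphism field with
components `J`. -/
def localRicci (g : E → E →L[ℝ] E →L[ℝ] ℝ) (J : E → E →L[ℝ] E) (x b c : E) : ℝ :=
  metricTrace (g x)
    ((g x).bilinearComp ((curvatureBilin (localChristoffel g) x c).flip b) (J x))

theorem localRicci_zero (g : E → E →L[ℝ] E →L[ℝ] ℝ) (J : E → E →L[ℝ] E) (x c : E) :
    localRicci g J x 0 c = 0 := by
  have h : (g x).bilinearComp ((curvatureBilin (localChristoffel g) x c).flip 0) (J x) =
      (0 : ℝ) • g x := by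
    ext v w; simp
  rw [localRicci, h, metricTrace_smul, zero_mul]

/-- `X^H ↦ X^V`, `X^V ↦ -X^H` in the adapted frame. -/
def frameJ₁ : E → E × E →L[ℝ] E × E := fun _ ↦
  (-(ContinuousLinearMap.snd ℝ E E)).prod (ContinuousLinearMap.fst ℝ E E)

/-- `X^H ↦ (J X)^V`, `X^V ↦ (J X)^H` in the adapted frame. -/
def frameJ₂ (J : E → E →L[ℝ] E) : E → E × E →L[ℝ] E × E := fun x ↦
  (J x ∘L ContinuousLinearMap.snd ℝ E E).prod (J x ∘L ContinuousLinearMap.fst ℝ E E)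

/-- `X^H ↦ -(J X)^H`, `X^V ↦ (J X)^V` in the adapted frame. -/
def frameJ₃ (J : E → E →L[ℝ] E) : E → E × E →L[ℝ] E × E := fun x ↦
  (-(J x ∘L ContinuousLinearMap.fst ℝ E E)).prod (J x ∘L ContinuousLinearMap.snd ℝ E E)

theorem frameJ₁_apply (x : E) (a : E × E) : frameJ₁ x a = (-a.2, a.1) := rfl

theorem frameJ₂_apply (J : E → E →L[ℝ] E) (x : E) (a : E × E) :
    frameJ₂ J x a = (J x a.2, J x a.1) := rfl

theorem frameJ₃_apply (J : E → E →L[ℝ] E) (x : E) (a : E × E) :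
    frameJ₃ J x a = (-J x a.1, J x a.2) := rfl

variable {J : E → E →L[ℝ] E} {x : E}

theorem differentiableAt_frameJ₂ (hJ : DifferentiableAt ℝ J x) :
    DifferentiableAt ℝ (frameJ₂ J) x := by
  have : frameJ₂ J = fun x ↦
      ContinuousLinearMap.inl ℝ E E ∘L J x ∘L ContinuousLinearMap.snd ℝ E E
      + ContinuousLinearMap.inr ℝ E E ∘L J x ∘L ContinuousLinearMap.fst ℝ E E := by
    ext x a <;> simp [frameJ₂_apply]
  rw [this]
  fun_prop

theorem differentiableAt_frameJ₃ (hJ : DifferentiableAt ℝ J x) :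
    DifferentiableAt ℝ (frameJ₃ J) x := by
  have : frameJ₃ J = fun x ↦
      -(ContinuousLinearMap.inl ℝ E E ∘L J x ∘L ContinuousLinearMap.fst ℝ E E)
      + ContinuousLinearMap.inr ℝ E E ∘L J x ∘L ContinuousLinearMap.snd ℝ E E := by
    ext x a <;> simp [frameJ₃_apply]
  rw [this]
  fun_prop

theorem fderiv_frameJ₂ (hJ : DifferentiableAt ℝ J x) (v : E) (a : E × E) :
    fderiv ℝ (frameJ₂ J) x v a = (fderiv ℝ J x v a.2, fderiv ℝ J x v a.1) := by
  have h (w : E) := hJ.hasFDerivAt.clm_apply (hasFDerivAt_const w x)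
  rw [← fderiv_clm_apply_const (differentiableAt_frameJ₂ hJ)]
  change fderiv ℝ (fun y ↦ (J y a.2, J y a.1)) x v = _
  rw [((h a.2).prodMk (h a.1)).fderiv]
  simp

theorem fderiv_frameJ₃ (hJ : DifferentiableAt ℝ J x) (v : E) (a : E × E) :
    fderiv ℝ (frameJ₃ J) x v a = (-fderiv ℝ J x v a.1, fderiv ℝ J x v a.2) := by
  have h (w : E) := hJ.hasFDerivAt.clm_apply (hasFDerivAt_const w x)
  rw [← fderiv_clm_apply_const (differentiableAt_frameJ₃ hJ)]
  change fderiv ℝ (fun y ↦ (-J y a.1, J y a.2)) x v = _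
  rw [((h a.1).fun_neg.prodMk (h a.2)).fderiv]
  simp

theorem curvatureTerm_horizontal {h : E →L[ℝ] E →L[ℝ] ℝ} {R : E → E → E} (a b : E) (c : E × E) :
    curvatureTerm h R (a, 0) (b, 0) c = -(1 / 2 * h (R a b) c.2) := by
  simp [curvatureTerm]

variable [FiniteDimensional ℝ E] {g : E → E →L[ℝ] E →L[ℝ] ℝ} {y : E}

/-- The Lie form of an endomorphism field given by `k` in the adapted frame, with respect to the
Sasaki metric, as a sum of contractions over horizontal and over vertical vectors. -/
theorem localLieForm_sasakiCoord (hg : ContDiffAt ℝ 2 g x) (hm : ∀ᶠ z in 𝓝 x, IsMetric (g z))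
    {k : E → E × E →L[ℝ] E × E} (hk : DifferentiableAt ℝ k x) {ε : ℝ}
    (hε : ∀ a b, sumForm (g x) (k x a) b = ε * sumForm (g x) a (k x b)) (c : E × E) :
    ∃ β₁ β₂ : E →L[ℝ] E →L[ℝ] ℝ,
      localLieForm (fun Y ↦ sasakiCoord (localChristoffel g) Y g)
        (fun Y ↦ endCoord (localChristoffel g) Y k) (x, y)
        (adaptedSymm (localChristoffel g) (x, y) c) =
          metricTrace (g x) β₁ + metricTrace (g x) β₂ ∧
      (∀ a b, β₁ a b =
        sumForm (g x) (fderiv ℝ k x a (b, 0)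
            + diagChristoffel (localChristoffel g x) a (k x (b, 0))
            - k x (diagChristoffel (localChristoffel g x) a (b, 0))) c
          + curvatureTerm (g x) (fun a b ↦ localCurvature (localChristoffel g) x a b y)
            (a, 0) (k x (b, 0)) c
          - ε * curvatureTerm (g x) (fun a b ↦ localCurvature (localChristoffel g) x a b y)
            (a, 0) (b, 0) (k x c)) ∧
      ∀ a b, β₂ a b =
        curvatureTerm (g x) (fun a b ↦ localCurvature (localChristoffel g) x a b y)
            (0, a) (k x (0, b)) c
          - ε * curvatureTerm (g x) (fun a b ↦ localCurvature (localChristoffel g) x a b y)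
            (0, a) (0, b) (k x c) := by
  have hg' : DifferentiableAt ℝ g x := hg.differentiableAt (by norm_num)
  have hΓ : DifferentiableAt ℝ (localChristoffel g) x :=
    (contDiffAt_localChristoffel (m := 1) hg hm.self_of_nhds (by norm_num)).differentiableAt
      (by norm_num)
  have hev : ∀ᶠ z in 𝓝 x, DifferentiableAt ℝ g z :=
    (hg.eventually (by simp)).mono fun z hz ↦ hz.differentiableAt (by norm_num)
  -- Torsion-freeness holds on a neighbourhood, hence passes to the derivative of `Γ`.
  have hs' := fderiv_symm_of_eventually hΓ <| by
    filter_upwards [hev, hm.eventually_nhds] with z hz hmz using localChristoffel_symm hz hmz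
  have key := structural_sasakiCoord (y := y) hg' hm hΓ hs' hk hε
  set Γ := localChristoffel g with hΓdef
  set β : E × E →L[ℝ] E × E →L[ℝ] ℝ :=
    ContinuousLinearMap.compL ℝ (E × E) (E × E) ℝ
      ((sasakiCoord Γ (x, y) g).flip (adaptedSymm Γ (x, y) c)) ∘L
    localNabla (localChristoffel (fun Y ↦ sasakiCoord Γ Y g) (x, y))
      (fun Y ↦ endCoord Γ Y k) (x, y) with hβ
  have hβ' (a b : E × E) : β (adaptedSymm Γ (x, y) a) (adaptedSymm Γ (x, y) b) = _ := key a b c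
  have hprod := metricTrace_prod (G := sasakiCoord Γ (x, y) g) (β := β) hm.self_of_nhds
    (IsMetric.sasakiCoord Γ (x, y) hm.self_of_nhds) (adaptedEquiv Γ (x, y))
    (fun ξ η ↦ rfl)
    (β₁ := β.bilinearComp (adaptedSymm Γ (x, y) ∘L ContinuousLinearMap.inl ℝ E E)
      (adaptedSymm Γ (x, y) ∘L ContinuousLinearMap.inl ℝ E E))
    (β₂ := β.bilinearComp (adaptedSymm Γ (x, y) ∘L ContinuousLinearMap.inr ℝ E E)
      (adaptedSymm Γ (x, y) ∘L ContinuousLinearMap.inr ℝ E E))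
    (fun v w ↦ rfl) (fun v w ↦ rfl)
  refine ⟨_, _, hprod, fun a b ↦ hβ' (a, 0) (b, 0), fun a b ↦ (hβ' (0, a) (0, b)).trans ?_⟩
  -- A vertical direction has zero horizontal part, so the covariant derivative of `k` drops out.
  simp [diagChristoffel, show ((0 : E), (0 : E)) = 0 from rfl]

/-- With `P(a,b) = g(R(a,X)y, b)`, where `X` is the horizontal part of the argument, the horizontal
sum is `P/2` plus an antisymmetric form and the vertical sum is minus half the transpose of `P`.
Their traces cancel. -/
theorem localLieForm_frameJ₁ (hg : ContDiffAt ℝ 2 g x) (hm : ∀ᶠ z in 𝓝 x, IsMetric (g z))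
    (c : E × E) :
    localLieForm (fun Y ↦ sasakiCoord (localChristoffel g) Y g)
        (fun Y ↦ endCoord (localChristoffel g) Y frameJ₁) (x, y)
        (adaptedSymm (localChristoffel g) (x, y) c) = 0 := by
  obtain ⟨β₁, β₂, h, h₁, h₂⟩ := localLieForm_sasakiCoord (y := y) hg hm
    (k := frameJ₁) (differentiableAt_const _) (ε := -1)
    (fun a b ↦ by simp [frameJ₁_apply, sumForm_apply]) c
  have hm := hm.self_of_nhds
  rw [h]
  let P : E →L[ℝ] E →L[ℝ] ℝ := g x ∘L (curvatureBilin (localChristoffel g) x y).flip c.1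
  have hP (a b : E) : P a b = g x (localCurvature (localChristoffel g) x a c.1 y) b := by
    simp [P, curvatureBilin_apply]
  have hd : fderiv ℝ (frameJ₁ (E := E)) x = 0 := by
    unfold frameJ₁; simp
  have e₂ : β₂ = (-(1 / 2) : ℝ) • P.flip := by
    ext a b
    simp [h₂, hP, frameJ₁_apply, curvatureTerm, localCurvature]
    ring
  have e₁ : β₁ = (1 / 2 : ℝ) • P + (β₁ - (1 / 2 : ℝ) • P) := by abel
  rw [e₂, e₁, metricTrace_add, metricTrace_smul, metricTrace_smul, hm.metricTrace_flip,
    hm.metricTrace_eq_zero_of_antisymm (β := β₁ - (1 / 2 : ℝ) • P)]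
  · ring
  · intro a b
    simp only [sub_apply, smul_apply, h₁, hd, hP, curvatureTerm_horizontal]
    simp only [frameJ₁_apply, curvatureTerm, diagChristoffel, sumForm_apply]
    rw [localCurvature_antisymm (localChristoffel g) x b a y]
    simp

variable (hJs : ∀ a b, g x (J x a) b = g x a (J x b))

include hJs

/-- Each of the two sums contributes half of the associated Ricci tensor: the horizontal one through
`P(a, Jb)`, the vertical one through the transpose of `P(Ja, b)`, which has the same trace because
`J` is self-adjoint. The covariant derivative of `J` appears only in the horizontal sum, paired with
the vertical part of the argument. -/
theorem localLieForm_frameJ₂ (hg : ContDiffAt ℝ 2 g x) (hm : ∀ᶠ z in 𝓝 x, IsMetric (g z))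
    (hJ : DifferentiableAt ℝ J x) (c : E × E) :
    localLieForm (fun Y ↦ sasakiCoord (localChristoffel g) Y g)
        (fun Y ↦ endCoord (localChristoffel g) Y (frameJ₂ J)) (x, y)
        (adaptedSymm (localChristoffel g) (x, y) c) =
      localLieForm g J x c.2 + localRicci g J x c.1 y := by
  obtain ⟨β₁, β₂, h, h₁, h₂⟩ := localLieForm_sasakiCoord (y := y) hg hm
    (k := frameJ₂ J) (differentiableAt_frameJ₂ hJ) (ε := 1)
    (fun a b ↦ by simp [frameJ₂_apply, sumForm_apply, hJs]; ring) c
  have hm := hm.self_of_nhds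
  rw [h]
  let P : E →L[ℝ] E →L[ℝ] ℝ := g x ∘L (curvatureBilin (localChristoffel g) x y).flip c.1
  have hP (a b : E) : P a b = g x (localCurvature (localChristoffel g) x a c.1 y) b := by
    simp [P, curvatureBilin_apply]
  let Q : E →L[ℝ] E →L[ℝ] ℝ :=
    (g x).bilinearComp ((curvatureBilin (localChristoffel g) x y).flip c.1) (J x)
  have hQ (a b : E) : Q a b = P a (J x b) := rfl
  let L : E →L[ℝ] E →L[ℝ] ℝ := ContinuousLinearMap.compL ℝ E E ℝ ((g x).flip c.2) ∘L
    localNabla (localChristoffel g x) J x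
  have hL (a b : E) : L a b = g x (localNabla (localChristoffel g x) J x a b) c.2 := rfl
  have e₂ : β₂ = (1 / 2 : ℝ) • (P ∘L J x).flip := by
    ext a b
    simp [h₂, hP, frameJ₂_apply, curvatureTerm, localCurvature]
  have e₁ : β₁ = L + (1 / 2 : ℝ) • Q + (β₁ - L - (1 / 2 : ℝ) • Q) := by abel
  rw [e₂, e₁, metricTrace_add, metricTrace_add, metricTrace_smul, metricTrace_smul,
    hm.metricTrace_flip, hm.metricTrace_comp_left_eq_right P hJs (β₁ := P ∘L J x) (β₂ := Q)
      (fun _ _ ↦ rfl) hQ,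
    hm.metricTrace_eq_zero_of_antisymm (β := β₁ - L - (1 / 2 : ℝ) • Q)]
  · change metricTrace (g x) L + 1 / 2 * metricTrace (g x) Q + 0 + 1 / 2 * metricTrace (g x) Q
      = metricTrace (g x) L + metricTrace (g x) Q
    ring
  · intro a b
    simp only [sub_apply, smul_apply, h₁, hL, hQ, hP, curvatureTerm_horizontal, localNabla_apply,
      fderiv_frameJ₂ hJ]
    simp only [frameJ₂_apply, curvatureTerm, diagChristoffel, sumForm_apply]
    rw [localCurvature_antisymm (localChristoffel g) x b a y]
    simp
    ring

/-- The structure preserves the horizontal and vertical spaces, so the vertical sum is zero. The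
horizontal sum has only curvature terms built from the antisymmetric form `g(R(a,b)y, ·)`, all of
trace zero, and `-∇J`. -/
theorem localLieForm_frameJ₃ (hg : ContDiffAt ℝ 2 g x) (hm : ∀ᶠ z in 𝓝 x, IsMetric (g z))
    (hJ : DifferentiableAt ℝ J x) (c : E × E) :
    localLieForm (fun Y ↦ sasakiCoord (localChristoffel g) Y g)
        (fun Y ↦ endCoord (localChristoffel g) Y (frameJ₃ J)) (x, y)
        (adaptedSymm (localChristoffel g) (x, y) c) = -localLieForm g J x c.1 := by
  obtain ⟨β₁, β₂, h, h₁, h₂⟩ := localLieForm_sasakiCoord (y := y) hg hm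
    (k := frameJ₃ J) (differentiableAt_frameJ₃ hJ) (ε := 1)
    (fun a b ↦ by simp [frameJ₃_apply, sumForm_apply, hJs]) c
  have hm := hm.self_of_nhds
  rw [h]
  let A : E →L[ℝ] E →L[ℝ] ℝ := ContinuousLinearMap.compL ℝ E E ℝ ((g x).flip c.2) ∘L
    curvatureBilin (localChristoffel g) x y
  have hA (a b : E) : A a b = g x (localCurvature (localChristoffel g) x a b y) c.2 := by
    rw [← curvatureBilin_apply]; rfl
  let L : E →L[ℝ] E →L[ℝ] ℝ := ContinuousLinearMap.compL ℝ E E ℝ ((g x).flip c.1) ∘L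
    localNabla (localChristoffel g x) J x
  have hL (a b : E) : L a b = g x (localNabla (localChristoffel g x) J x a b) c.1 := rfl
  let B : E →L[ℝ] E →L[ℝ] ℝ := A.bilinearComp (ContinuousLinearMap.id ℝ E) (J x)
  have hB (a b : E) : B a b = A a (J x b) := rfl
  -- For antisymmetric `A`, the form `A(Ja, b)` is minus the transpose of `A(a, Jb)`, yet the two
  -- have equal trace as `J` is self-adjoint.
  have hB0 : metricTrace (g x) B = 0 := by
    have e : A ∘L J x = (-1 : ℝ) • B.flip := by
      ext a b
      simp only [ContinuousLinearMap.comp_apply, smul_apply, ContinuousLinearMap.flip_apply, hB, hA]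
      rw [localCurvature_antisymm]
      simp
    have h3 := hm.metricTrace_comp_left_eq_right A hJs (β₁ := A ∘L J x) (β₂ := B)
      (fun _ _ ↦ rfl) hB
    rw [e, metricTrace_smul, hm.metricTrace_flip] at h3
    linarith
  have e₂ : β₂ = (0 : ℝ) • L := by
    ext a b
    simp [h₂, frameJ₃_apply, curvatureTerm, localCurvature]
  have e₁ : β₁ = (-1 : ℝ) • L + (1 / 2 : ℝ) • B + (β₁ - (-1 : ℝ) • L - (1 / 2 : ℝ) • B) := by abel
  rw [e₂, e₁, metricTrace_add, metricTrace_add, metricTrace_smul, metricTrace_smul,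
    metricTrace_smul, hB0,
    hm.metricTrace_eq_zero_of_antisymm (β := β₁ - (-1 : ℝ) • L - (1 / 2 : ℝ) • B)]
  · change -1 * metricTrace (g x) L + 1 / 2 * 0 + 0 + 0 * metricTrace (g x) L
      = -metricTrace (g x) L
    ring
  · intro a b
    simp only [sub_apply, smul_apply, h₁, hL, hB, hA, curvatureTerm_horizontal, localNabla_apply,
      fderiv_frameJ₃ hJ]
    simp only [frameJ₃_apply, curvatureTerm, diagChristoffel, sumForm_apply]
    rw [localCurvature_antisymm (localChristoffel g) x b a y]
    have hneg (a b : E) : localCurvature (localChristoffel g) x a (-b) y =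
        -localCurvature (localChristoffel g) x a b y := by
      rw [← curvatureBilin_apply, map_neg, curvatureBilin_apply]
    simp [hneg]
    ring

end LieForms

/-! ### Change of coordinates for Christoffel symbols. -/

section Transformation

variable {E : Type*} [NormedAddCommGroup E] [NormedSpace ℝ E] [FiniteDimensional ℝ E]

/-- The transformation law of the Christoffel symbols under a change of coordinates `φ`. -/
theorem localChristoffel_pullback {g₀ g₁ : E → E →L[ℝ] E →L[ℝ] ℝ} {φ : E → E} {x : E}
    (h : ∀ᶠ z in 𝓝 x, ∀ v w, g₀ z v w = g₁ (φ z) (fderiv ℝ φ z v) (fderiv ℝ φ z w))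
    (hφ : ContDiffAt ℝ 2 φ x) (hg₁ : DifferentiableAt ℝ g₁ (φ x)) (hm₀ : IsMetric (g₀ x))
    (hm₁ : ∀ᶠ z in 𝓝 (φ x), IsMetric (g₁ z))
    (hA : Function.Surjective (fderiv ℝ φ x)) (v w : E) :
    localChristoffel g₁ (φ x) (fderiv ℝ φ x v) (fderiv ℝ φ x w) =
      fderiv ℝ φ x (localChristoffel g₀ x v w) - fderiv ℝ (fderiv ℝ φ) x v w := by
  have hφ1 : DifferentiableAt ℝ φ x := hφ.differentiableAt (by norm_num)
  have hφ2 : DifferentiableAt ℝ (fderiv ℝ φ) x :=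
    (hφ.fderiv_right (m := 1) (by norm_num)).differentiableAt (by norm_num)
  have hsymm (a b : E) : fderiv ℝ (fderiv ℝ φ) x a b = fderiv ℝ (fderiv ℝ φ) x b a :=
    hφ.isSymmSndFDerivAt (by simp) a b
  have hcomp : DifferentiableAt ℝ (fun z ↦ g₁ (φ z)) x := hg₁.comp x hφ1
  have hg₀ : g₀ =ᶠ[𝓝 x] fun z ↦ (g₁ (φ z)).bilinearComp (fderiv ℝ φ z) (fderiv ℝ φ z) :=
    h.mono fun z hz ↦ by ext a b; exact hz a b
  have hd : DifferentiableAt ℝ g₀ x := by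
    rw [hg₀.differentiableAt_iff]
    exact DifferentiableAt.bilinearComp hcomp hφ2
  have hD (a b c : E) : fderiv ℝ g₀ x a b c =
      fderiv ℝ g₁ (φ x) (fderiv ℝ φ x a) (fderiv ℝ φ x b) (fderiv ℝ φ x c)
        + g₁ (φ x) (fderiv ℝ (fderiv ℝ φ) x a b) (fderiv ℝ φ x c)
        + g₁ (φ x) (fderiv ℝ φ x b) (fderiv ℝ (fderiv ℝ φ) x a c) := by
    rw [← fderiv_clm_apply_const hd, ← fderiv_clm_apply_const (by fun_prop)]
    have h1 := hg₁.hasFDerivAt.comp x hφ1.hasFDerivAt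
    have h2 (b : E) := hφ2.hasFDerivAt.clm_apply (hasFDerivAt_const b x)
    have h3 := (h1.clm_apply (h2 b)).clm_apply (h2 c)
    have h4 : (fun z ↦ g₀ z b c) =ᶠ[𝓝 x]
        fun z ↦ g₁ (φ z) (fderiv ℝ φ z b) (fderiv ℝ φ z c) := h.mono fun z hz ↦ hz b c
    rw [h4.fderiv_eq]
    erw [h3.fderiv]
    simp
    ring
  have hm := hm₁.self_of_nhds
  have hpt := h.self_of_nhds
  refine hm.ext_left fun z' ↦ ?_
  -- Every test vector is an image under the differential, so both sides can be compared by the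
  -- Koszul formulas of `g₀` and `g₁`.
  obtain ⟨z, rfl⟩ := hA z'
  rw [map_sub, sub_apply, ← hpt, localChristoffel_spec hm, localChristoffel_spec hm₀, hD, hD, hD,
    hsymm w v, hsymm z v, hsymm z w, hm.symm (fderiv ℝ φ x v) (fderiv ℝ (fderiv ℝ φ) x w z),
    hm.symm (fderiv ℝ φ x w) (fderiv ℝ (fderiv ℝ φ) x v z)]
  ring

end Transformation

/-! ### Coordinate changes and components of tensor fields. -/

section Charts

variable {E : Type*} [NormedAddCommGroup E] [NormedSpace ℝ E]
  {H : Type*} [TopologicalSpace H] (I : ModelWithCorners ℝ E H)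
  {N : Type*} [TopologicalSpace N] [ChartedSpace H N]

/-- The change of coordinates from the preferred chart at `p` to the preferred chart at `q`. -/
def transition (p q : N) : E → E := extChartAt I q ∘ (extChartAt I p).symm

variable {I}

theorem transition_apply (p q : N) (x : E) :
    transition I p q x = extChartAt I q ((extChartAt I p).symm x) := rfl

theorem symm_transition {p q : N} {x : E}
    (hq : (extChartAt I p).symm x ∈ (extChartAt I q).source) :
    (extChartAt I q).symm (transition I p q x) = (extChartAt I p).symm x :=
  (extChartAt I q).left_inv hq

theorem transition_mem_target {p q : N} {x : E}
    (hq : (extChartAt I p).symm x ∈ (extChartAt I q).source) :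
    transition I p q x ∈ (extChartAt I q).target := (extChartAt I q).map_source hq

variable [I.Boundaryless]

theorem target_mem_nhds {p : N} {x : E} (hx : x ∈ (extChartAt I p).target) :
    (extChartAt I p).target ∈ 𝓝 x := (isOpen_extChartAt_target p).mem_nhds hx

theorem eventually_symm_mem_source {p q : N} {x : E} (hx : x ∈ (extChartAt I p).target)
    (hq : (extChartAt I p).symm x ∈ (extChartAt I q).source) :
    ∀ᶠ z in 𝓝 x, z ∈ (extChartAt I p).target ∧
      (extChartAt I p).symm z ∈ (extChartAt I q).source :=
  Filter.Eventually.and (target_mem_nhds hx)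
    ((continuousAt_extChartAt_symm'' hx).eventually ((isOpen_extChartAt_source q).mem_nhds hq))

theorem contDiffAt_transition {n : WithTop ℕ∞} [IsManifold I n N] {p q : N} {x : E}
    (hx : x ∈ (extChartAt I p).target) (hq : (extChartAt I p).symm x ∈ (extChartAt I q).source) :
    ContDiffAt ℝ n (transition I p q) x := by
  have := contDiffWithinAt_ext_coord_change (I := I) (n := n) q p (y := x) (by
    rw [PartialEquiv.trans_source]; exact ⟨hx, hq⟩)
  rwa [I.range_eq_univ, contDiffWithinAt_univ] at this

theorem fderiv_transition_self {p : N} {x : E} (hx : x ∈ (extChartAt I p).target) :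
    fderiv ℝ (transition I p p) x = ContinuousLinearMap.id ℝ E := by
  have : transition I p p =ᶠ[𝓝 x] id := by
    filter_upwards [target_mem_nhds hx] with z hz using (extChartAt I p).right_inv hz
  rw [this.fderiv_eq, fderiv_id]

variable [IsManifold I 1 N]

theorem fderiv_transition_comp {p q r : N} {x : E} (hx : x ∈ (extChartAt I p).target)
    (hq : (extChartAt I p).symm x ∈ (extChartAt I q).source)
    (hr : (extChartAt I p).symm x ∈ (extChartAt I r).source) (v : E) :
    fderiv ℝ (transition I q r) (transition I p q x) (fderiv ℝ (transition I p q) x v) =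
      fderiv ℝ (transition I p r) x v := by
  have h : transition I p r =ᶠ[𝓝 x] transition I q r ∘ transition I p q := by
    filter_upwards [eventually_symm_mem_source hx hq] with z hz
    simp only [Function.comp_apply]
    rw [transition_apply q r, symm_transition hz.2, transition_apply]
  rw [h.fderiv_eq, fderiv_comp]
  · rfl
  · refine (contDiffAt_transition (n := 1) (transition_mem_target hq) ?_).differentiableAt one_ne_zero
    rwa [symm_transition hq]
  · exact (contDiffAt_transition (n := 1) hx hq).differentiableAt one_ne_zero

theorem fderiv_transition_transition {p q : N} {x : E} (hx : x ∈ (extChartAt I p).target)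
    (hq : (extChartAt I p).symm x ∈ (extChartAt I q).source) (v : E) :
    fderiv ℝ (transition I q p) (transition I p q x) (fderiv ℝ (transition I p q) x v) = v := by
  rw [fderiv_transition_comp hx hq ((extChartAt I p).map_target hx), fderiv_transition_self hx]
  rfl

theorem fderiv_transition_surjective {p q : N} {x : E} (hx : x ∈ (extChartAt I p).target)
    (hq : (extChartAt I p).symm x ∈ (extChartAt I q).source) :
    Function.Surjective (fderiv ℝ (transition I p q) x) := by
  intro w
  have h := fderiv_transition_transition (p := q) (q := p) (transition_mem_target hq)
    (by rw [symm_transition hq]; exact (extChartAt I p).map_target hx) w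
  have e : transition I q p (transition I p q x) = x := by
    rw [transition_apply q p, symm_transition hq, (extChartAt I p).right_inv hx]
  rw [e] at h
  exact ⟨_, h⟩

/-- The tangent space at a point is `E` read in that point's preferred chart, so the coordinate
frame of another chart is the differential of a change of coordinates whose target chart varies with
`x`. -/
theorem coordFrame_eq {p : N} {x : E} (hx : x ∈ (extChartAt I p).target) :
    (coordFrame I p x : E →L[ℝ] E) =
      fderiv ℝ (transition I p ((extChartAt I p).symm x)) x := by
  have h : MDifferentiableAt 𝓘(ℝ, E) I (extChartAt I p).symm x :=
    (mdifferentiableOn_extChartAt_symm (I := I) (x := p)).mdifferentiableAt (target_mem_nhds hx)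
  have e : (mfderiv 𝓘(ℝ, E) I (extChartAt I p).symm x : E →L[ℝ] E) =
      fderivWithin ℝ (transition I p ((extChartAt I p).symm x)) (Set.range 𝓘(ℝ, E))
        (extChartAt 𝓘(ℝ, E) x x) := h.mfderiv
  refine Eq.trans e ?_
  rw [(𝓘(ℝ, E)).range_eq_univ, fderivWithin_univ]
  rfl

theorem coordCoframe_coordFrame {p : N} {x : E} (hx : x ∈ (extChartAt I p).target) (v : E) :
    coordCoframe I p x (coordFrame I p x v) = v := by
  have h := mfderiv_extChartAt_comp_mfderivWithin_extChartAt_symm (I := I) hx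
  rw [I.range_eq_univ, mfderivWithin_univ] at h
  exact congrArg (fun f : E →L[ℝ] E ↦ f v) h

theorem coordFrame_coordCoframe {p : N} {x : E} (hx : x ∈ (extChartAt I p).target) (v : E) :
    coordFrame I p x (coordCoframe I p x v) = v := by
  have h := mfderivWithin_extChartAt_symm_comp_mfderiv_extChartAt (I := I) hx
  rw [I.range_eq_univ, mfderivWithin_univ] at h
  exact congrArg (fun f : E →L[ℝ] E ↦ f v) h

/-- The point is a free variable `r` with an equation, so that it can be replaced without rewriting
inside dependent types. -/
theorem FormField.inChart_apply (g : FormField I N) {p r : N} {x : E}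
    (hx : x ∈ (extChartAt I p).target) (hr : (extChartAt I p).symm x = r) (v w : E) :
    g.inChart p x v w =
      g.val r (fderiv ℝ (transition I p r) x v) (fderiv ℝ (transition I p r) x w) := by
  subst hr
  rw [← coordFrame_eq hx]
  rfl

theorem EndField.fderiv_transition_inChart (J : EndField I N) {p r : N} {x : E}
    (hx : x ∈ (extChartAt I p).target) (hr : (extChartAt I p).symm x = r) (v : E) :
    fderiv ℝ (transition I p r) x (J.inChart p x v) =
      J.val r (fderiv ℝ (transition I p r) x v) := by
  subst hr
  rw [← coordFrame_eq hx]
  exact coordFrame_coordCoframe hx _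

theorem EndField.inChart_eq_of (J : EndField I N) {p r : N} {x : E}
    (hx : x ∈ (extChartAt I p).target) (hr : (extChartAt I p).symm x = r) {v w : E}
    (h : J.val r (fderiv ℝ (transition I p r) x v) = fderiv ℝ (transition I p r) x w) :
    J.inChart p x v = w := by
  subst hr
  rw [← coordFrame_eq hx] at h
  have h' := congrArg (fun a : E ↦ (coordCoframe I p x : E →L[ℝ] E) a) h
  exact h'.trans (coordCoframe_coordFrame hx w)

theorem FormField.inChart_self (g : FormField I N) (p : N) :
    g.inChart p (extChartAt I p p) = g.val p := by
  ext v w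
  rw [g.inChart_apply (mem_extChartAt_target p) (extChartAt_to_inv p),
    fderiv_transition_self (mem_extChartAt_target p)]
  rfl

theorem EndField.inChart_self (J : EndField I N) (p : N) :
    J.inChart p (extChartAt I p p) = J.val p := by
  ext v
  refine J.inChart_eq_of (mem_extChartAt_target p) (extChartAt_to_inv p) ?_
  rw [fderiv_transition_self (mem_extChartAt_target p)]
  rfl

theorem FormField.inChart_transition (g : FormField I N) {p q : N} {x : E}
    (hx : x ∈ (extChartAt I p).target)
    (hq : (extChartAt I p).symm x ∈ (extChartAt I q).source) (v w : E) :
    g.inChart p x v w = g.inChart q (transition I p q x) (fderiv ℝ (transition I p q) x v)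
      (fderiv ℝ (transition I p q) x w) := by
  have hr := mem_extChartAt_source (I := I) ((extChartAt I p).symm x)
  rw [g.inChart_apply hx rfl, g.inChart_apply (transition_mem_target hq) (symm_transition hq),
    fderiv_transition_comp hx hq hr, fderiv_transition_comp hx hq hr]

theorem lieForm_eq (g : FormField I N) (J : EndField I N) (p : N) (z : E) :
    lieForm g J p z = localLieForm (g.inChart p) (J.inChart p) (extChartAt I p p) z := by
  change metricTrace (g.val p) (ContinuousLinearMap.compL ℝ E E ℝ ((g.val p).flip z) ∘L
    localNabla (localChristoffel (g.inChart p) (extChartAt I p p)) (J.inChart p)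
      (extChartAt I p p)) = _
  rw [← FormField.inChart_self]
  rfl

theorem associatedRicci_eq (g : FormField I N) (J : EndField I N) (p : N) (y z : E) :
    associatedRicci g J p y z =
      localRicci (g.inChart p) (J.inChart p) (extChartAt I p p) y z := by
  have h : curvature g p y z =
      (curvatureBilin (localChristoffel (g.inChart p)) (extChartAt I p p) z).flip y := by
    ext v
    rw [curvature_apply, ContinuousLinearMap.flip_apply, curvatureBilin_apply]
    rfl
  change metricTrace (g.val p) ((g.val p).bilinearComp (curvature g p y z) (J.val p)) = _
  rw [← FormField.inChart_self, ← EndField.inChart_self, h]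
  rfl

end Charts

/-! ### Smoothness and algebra of the structure in a chart. -/

section Smoothness

variable {E : Type*} [NormedAddCommGroup E] [NormedSpace ℝ E]
  {H : Type*} [TopologicalSpace H] {I : ModelWithCorners ℝ E H} [I.Boundaryless]
  {M : Type*} [TopologicalSpace M] [ChartedSpace H M] [IsManifold I ∞ M]

theorem symmL_trivializationAt_eq_coordFrame {p : M} {x : E} (hx : x ∈ (extChartAt I p).target) :
    (trivializationAt E (TangentSpace I) p).symmL ℝ ((extChartAt I p).symm x) =
      coordFrame I p x := by
  have hs : (extChartAt I p).symm x ∈ (chartAt H p).source := by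
    rw [← extChartAt_source I]; exact (extChartAt I p).map_target hx
  rw [TangentBundle.symmL_trivializationAt hs, I.range_eq_univ, mfderivWithin_univ,
    (extChartAt I p).right_inv hx]
  rfl

omit [I.Boundaryless] in
theorem continuousLinearMapAt_trivializationAt_eq_coordCoframe {p : M} {x : E}
    (hx : x ∈ (extChartAt I p).target) :
    (trivializationAt E (TangentSpace I) p).continuousLinearMapAt ℝ ((extChartAt I p).symm x) =
      coordCoframe I p x := by
  have hs : (extChartAt I p).symm x ∈ (chartAt H p).source := by
    rw [← extChartAt_source I]; exact (extChartAt I p).map_target hx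
  exact TangentBundle.continuousLinearMapAt_trivializationAt hs

namespace AlmostSkewHermitian

variable (S : AlmostSkewHermitian I M)

/-- Smoothness of the section is smoothness in the bundle trivialization at `p`, and over the chart
that trivialization is the differential of the chart. -/
theorem contDiffAt_J_inChart (p : M) :
    ContDiffAt ℝ ∞ (S.J.inChart p) (extChartAt I p p) := by
  have h := ((contMDiffAt_hom_bundle _).1 (S.smooth_J p)).2
  have h2 := (contMDiffAt_iff.1 h).2
  rw [I.range_eq_univ, contDiffWithinAt_univ] at h2
  refine h2.congr_of_eventuallyEq ?_
  filter_upwards [target_mem_nhds (mem_extChartAt_target (I := I) p)] with x hx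
  change _ = ContinuousLinearMap.inCoordinates E (TangentSpace I) E (TangentSpace I) p
    ((extChartAt I p).symm x) p ((extChartAt I p).symm x) (S.J ((extChartAt I p).symm x))
  rw [ContinuousLinearMap.inCoordinates, symmL_trivializationAt_eq_coordFrame hx,
    continuousLinearMapAt_trivializationAt_eq_coordCoframe hx]
  rfl

theorem contDiffAt_g_inChart (p : M) :
    ContDiffAt ℝ ∞ (S.g.inChart p) (extChartAt I p p) := by
  have h := ((contMDiffAt_hom_bundle _).1 (S.smooth_g p)).2
  have h2 := (contMDiffAt_iff.1 h).2
  rw [I.range_eq_univ, contDiffWithinAt_univ] at h2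
  refine h2.congr_of_eventuallyEq ?_
  filter_upwards [target_mem_nhds (mem_extChartAt_target (I := I) p)] with x hx
  change _ = ContinuousLinearMap.inCoordinates E (TangentSpace I) (E →L[ℝ] ℝ)
    (fun q : M ↦ TangentSpace I q →L[ℝ] ℝ) p
    ((extChartAt I p).symm x) p ((extChartAt I p).symm x) (S.g ((extChartAt I p).symm x))
  have hs : (extChartAt I p).symm x ∈ (chartAt H p).source := by
    rw [← extChartAt_source I]; exact (extChartAt I p).map_target hx
  ext v w
  have h3 := inCoordinates_apply_eq₂ (F₁ := E) (F₂ := E) (F₃ := ℝ) (E₁ := TangentSpace I)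
    (E₂ := TangentSpace I) (E₃ := Bundle.Trivial M ℝ) (x₀ := p)
    (ϕ := S.g ((extChartAt I p).symm x)) (v := v) (w := w) hs hs (Set.mem_univ _)
  refine Eq.trans ?_ h3.symm
  have h4 (v : E) : (trivializationAt E (TangentSpace I) p).symm ((extChartAt I p).symm x) v =
      coordFrame I p x v := by
    rw [← symmL_trivializationAt_eq_coordFrame hx, Trivialization.symmL_apply _ hs]
  rw [h4, h4]
  simp
  rfl

omit [I.Boundaryless] in
theorem isMetric_val (p : M) : IsMetric (S.g.val p) where
  symm v w := S.symm p v w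
  nondegenerate v H := S.nondegenerate p v H

theorem isMetric_inChart {p : M} {x : E} (hx : x ∈ (extChartAt I p).target) :
    IsMetric (S.g.inChart p x) := by
  set r := (extChartAt I p).symm x with hr
  have hrs : (extChartAt I p).symm x ∈ (extChartAt I r).source := by
    rw [← hr]; exact mem_extChartAt_source r
  have hi (v : E) := fderiv_transition_transition hx hrs v
  refine ⟨fun v w ↦ ?_, fun v H ↦ ?_⟩
  · rw [S.g.inChart_apply hx hr.symm, S.g.inChart_apply hx hr.symm]
    exact (S.isMetric_val r).symm _ _
  · have h0 : fderiv ℝ (transition I p r) x v = 0 := by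
      refine (S.isMetric_val r).nondegenerate _ fun w ↦ ?_
      obtain ⟨w, rfl⟩ := fderiv_transition_surjective hx hrs w
      rw [← S.g.inChart_apply hx hr.symm]
      exact H w
    rw [← hi v, h0, map_zero]

theorem eventually_isMetric_inChart {p : M} {x : E} (hx : x ∈ (extChartAt I p).target) :
    ∀ᶠ z in 𝓝 x, IsMetric (S.g.inChart p z) :=
  Filter.Eventually.mono (target_mem_nhds hx) fun _ hz ↦ S.isMetric_inChart hz

-- Apply the anti-isometry property to `v` and `Jw` and use `J² = -1`; this self-adjointness is all
-- that the Lie form computations need from `J`.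
omit [I.Boundaryless] in
theorem g_J_apply (p : M) (v w : E) :
    S.g.val p (S.J.val p v) w = S.g.val p v (S.J.val p w) := by
  have h1 : S.J.val p (S.J.val p w) = -w := S.J_J p w
  have h2 : S.g.val p (S.J.val p v) (S.J.val p (S.J.val p w)) = -S.g.val p v (S.J.val p w) :=
    S.anti p v (S.J.val p w)
  rw [h1, map_neg] at h2
  exact neg_injective h2

end AlmostSkewHermitian

end Smoothness

/-! ### The charts of the tangent bundle. -/

section Sasaki

variable {E : Type*} [NormedAddCommGroup E] [NormedSpace ℝ E]
  {H : Type*} [TopologicalSpace H] {I : ModelWithCorners ℝ E H} [I.Boundaryless]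
  {M : Type*} [TopologicalSpace M] [ChartedSpace H M] [IsManifold I ∞ M]

theorem extChartAt_tangent_apply (u w : TangentBundle I M) :
    extChartAt I.tangent u w = (extChartAt I u.proj w.proj,
      fderiv ℝ (transition I w.proj u.proj) (extChartAt I w.proj w.proj) w.snd) := by
  have h : extChartAt I.tangent u w = (extChartAt I u.proj w.proj,
      fderivWithin ℝ (transition I w.proj u.proj) (Set.range I) (extChartAt I w.proj w.proj)
        w.snd) := rfl
  rw [h, I.range_eq_univ, fderivWithin_univ]

omit [I.Boundaryless] in
theorem mem_extChartAt_tangent_source {u w : TangentBundle I M} :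
    w ∈ (extChartAt I.tangent u).source ↔ w.proj ∈ (extChartAt I u.proj).source := by
  rw [extChartAt_source, extChartAt_source]
  exact TangentBundle.mem_chart_source_iff w u

theorem extChartAt_tangent_symm {u : TangentBundle I M} {X : E × E}
    (hX : X.1 ∈ (extChartAt I u.proj).target) :
    (extChartAt I.tangent u).symm X = ⟨(extChartAt I u.proj).symm X.1,
      fderiv ℝ (transition I u.proj ((extChartAt I u.proj).symm X.1)) X.1 X.2⟩ := by
  set w : TangentBundle I M := ⟨(extChartAt I u.proj).symm X.1,
    fderiv ℝ (transition I u.proj ((extChartAt I u.proj).symm X.1)) X.1 X.2⟩ with hw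
  have hws : w ∈ (extChartAt I.tangent u).source :=
    mem_extChartAt_tangent_source.2 ((extChartAt I u.proj).map_target hX)
  have he : extChartAt I.tangent u w = X := by
    rw [extChartAt_tangent_apply]
    refine Prod.ext ((extChartAt I u.proj).right_inv hX) ?_
    exact fderiv_transition_transition hX
      (mem_extChartAt_source (I := I) ((extChartAt I u.proj).symm X.1)) X.2
  rw [← he, (extChartAt I.tangent u).left_inv hws]

end Sasaki

/-! ### The Sasaki metric and the three structures in a chart of `TM`. -/

section Sasaki

variable {E : Type*} [NormedAddCommGroup E] [NormedSpace ℝ E]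
  {H : Type*} [TopologicalSpace H] {I : ModelWithCorners ℝ E H} [I.Boundaryless]
  {M : Type*} [TopologicalSpace M] [ChartedSpace H M] [IsManifold I ∞ M]

/-- The induced coordinates change by `(x, y) ↦ (φ x, Dφ(x) y)`; the second derivative of `φ` comes
from the factor `Dφ(x)`. -/
theorem fderiv_transition_tangent {u w : TangentBundle I M} {X : E × E}
    (hX : X.1 ∈ (extChartAt I u.proj).target)
    (hw : (extChartAt I u.proj).symm X.1 ∈ (extChartAt I w.proj).source) (ξ : E × E) :
    fderiv ℝ (transition I.tangent u w) X ξ =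
      (fderiv ℝ (transition I u.proj w.proj) X.1 ξ.1,
        fderiv ℝ (fderiv ℝ (transition I u.proj w.proj)) X.1 ξ.1 X.2
          + fderiv ℝ (transition I u.proj w.proj) X.1 ξ.2) := by
  set φ := transition I u.proj w.proj with hφ
  have hev : transition I.tangent u w =ᶠ[𝓝 X] fun Y ↦ (φ Y.1, fderiv ℝ φ Y.1 Y.2) := by
    filter_upwards [continuousAt_fst.eventually (eventually_symm_mem_source hX hw)] with Y hY
    rw [transition_apply, extChartAt_tangent_symm hY.1, extChartAt_tangent_apply]
    refine Prod.ext rfl ?_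
    exact fderiv_transition_comp hY.1 (mem_extChartAt_source (I := I) _) hY.2 Y.2
  have hc : ContDiffAt ℝ 2 φ X.1 :=
    (contDiffAt_transition (n := ∞) hX hw).of_le (WithTop.coe_le_coe.2 (le_top : (2 : ℕ∞) ≤ ⊤))
  have h1 : HasFDerivAt φ (fderiv ℝ φ X.1) X.1 :=
    (hc.differentiableAt (by norm_num)).hasFDerivAt
  have h2 : HasFDerivAt (fderiv ℝ φ) (fderiv ℝ (fderiv ℝ φ) X.1) X.1 :=
    ((hc.fderiv_right (m := 1) (by norm_num)).differentiableAt (by norm_num)).hasFDerivAt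
  have h3 := (h1.comp X hasFDerivAt_fst).prodMk
    ((h2.comp X hasFDerivAt_fst).clm_apply hasFDerivAt_snd)
  rw [hev.fderiv_eq]
  erw [h3.fderiv]
  simp [add_comm]

namespace AlmostSkewHermitian

variable [FiniteDimensional ℝ E] (S : AlmostSkewHermitian I M)

/-- The differential of the change of coordinates on the tangent bundle, in adapted frames. -/
theorem adapted_fderiv_transition {u w : TangentBundle I M} {X : E × E}
    (hX : X.1 ∈ (extChartAt I u.proj).target) (hw : (extChartAt I.tangent u).symm X = w)
    (ξ : E × E) :
    (horizontalPart w (fderiv ℝ (transition I.tangent u w) X ξ) =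
      fderiv ℝ (transition I u.proj w.proj) X.1
        (adapted (localChristoffel (S.g.inChart u.proj)) X ξ).1) ∧
    verticalPart S.g w (fderiv ℝ (transition I.tangent u w) X ξ) =
      fderiv ℝ (transition I u.proj w.proj) X.1
        (adapted (localChristoffel (S.g.inChart u.proj)) X ξ).2 := by
  rw [extChartAt_tangent_symm hX] at hw
  subst hw
  set r := (extChartAt I u.proj).symm X.1 with hr
  have hrs : (extChartAt I u.proj).symm X.1 ∈ (extChartAt I r).source := by
    rw [← hr]; exact mem_extChartAt_source r
  rw [fderiv_transition_tangent (w := ⟨r, fderiv ℝ (transition I u.proj r) X.1 X.2⟩) hX hrs]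
  refine ⟨rfl, ?_⟩
  have hc : ContDiffAt ℝ 2 (transition I u.proj r) X.1 :=
    (contDiffAt_transition (n := ∞) hX hrs).of_le (WithTop.coe_le_coe.2 (le_top : (2 : ℕ∞) ≤ ⊤))
  have hd : DifferentiableAt ℝ (S.g.inChart r) (extChartAt I r r) :=
    (S.contDiffAt_g_inChart r).differentiableAt (by simp)
  have hΓ := localChristoffel_pullback (g₀ := S.g.inChart u.proj) (g₁ := S.g.inChart r)
    (φ := transition I u.proj r) (x := X.1)
    ((eventually_symm_mem_source hX hrs).mono
      fun z hz v w ↦ S.g.inChart_transition hz.1 hz.2 v w) hc hd (S.isMetric_inChart hX)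
    (S.eventually_isMetric_inChart (mem_extChartAt_target r))
    (fderiv_transition_surjective hX hrs) X.2 ξ.1
  have hsymm : fderiv ℝ (fderiv ℝ (transition I u.proj r)) X.1 X.2 ξ.1 =
      fderiv ℝ (fderiv ℝ (transition I u.proj r)) X.1 ξ.1 X.2 :=
    hc.isSymmSndFDerivAt (by simp) _ _
  change fderiv ℝ (fderiv ℝ (transition I u.proj r)) X.1 ξ.1 X.2
      + fderiv ℝ (transition I u.proj r) X.1 ξ.2
      + localChristoffel (S.g.inChart r) (transition I u.proj r X.1)
        (fderiv ℝ (transition I u.proj r) X.1 X.2) (fderiv ℝ (transition I u.proj r) X.1 ξ.1)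
      = fderiv ℝ (transition I u.proj r) X.1
        (ξ.2 + localChristoffel (S.g.inChart u.proj) X.1 X.2 ξ.1)
  -- The second derivative of the coordinate change cancels the inhomogeneous term in the
  -- transformation law of `Γ`.
  rw [hΓ, hsymm, map_add]
  abel

omit [FiniteDimensional ℝ E] in
theorem mem_extChartAt_tangent_target {u : TangentBundle I M} {X : E × E}
    (hX : X.1 ∈ (extChartAt I u.proj).target) : X ∈ (extChartAt I.tangent u).target := by
  have : extChartAt I.tangent u ((extChartAt I.tangent u).symm X) = X := by
    rw [extChartAt_tangent_symm hX, extChartAt_tangent_apply]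
    refine Prod.ext ((extChartAt I u.proj).right_inv hX) ?_
    exact fderiv_transition_transition hX
      (mem_extChartAt_source (I := I) ((extChartAt I u.proj).symm X.1)) X.2
  rw [← this]
  refine (extChartAt I.tangent u).map_source (mem_extChartAt_tangent_source.2 ?_)
  rw [extChartAt_tangent_symm hX]
  exact (extChartAt I u.proj).map_target hX

omit [FiniteDimensional ℝ E] in
theorem proj_extChartAt_tangent_symm {u w : TangentBundle I M} {X : E × E}
    (hX : X.1 ∈ (extChartAt I u.proj).target) (hw : (extChartAt I.tangent u).symm X = w) :
    (extChartAt I u.proj).symm X.1 = w.proj := by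
  rw [← hw, extChartAt_tangent_symm hX]

/-- Horizontal and vertical parts at the point and the components of `g` are related to those in the
fixed chart by the same differential on `M`. -/
theorem sasaki_inChart {u : TangentBundle I M} {X : E × E}
    (hX : X.1 ∈ (extChartAt I u.proj).target) :
    S.sasaki.inChart u X =
      sasakiCoord (localChristoffel (S.g.inChart u.proj)) X (S.g.inChart u.proj) := by
  refine ContinuousLinearMap.ext fun ξ ↦ ContinuousLinearMap.ext fun η ↦ ?_
  obtain ⟨w, hw⟩ : ∃ w, (extChartAt I.tangent u).symm X = w := ⟨_, rfl⟩
  have hp := proj_extChartAt_tangent_symm hX hw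
  rw [S.sasaki.inChart_apply (mem_extChartAt_tangent_target hX) hw, sasakiCoord_apply,
    sumForm_apply, S.g.inChart_apply hX hp, S.g.inChart_apply hX hp,
    ← (S.adapted_fderiv_transition hX hw ξ).1, ← (S.adapted_fderiv_transition hX hw ξ).2,
    ← (S.adapted_fderiv_transition hX hw η).1, ← (S.adapted_fderiv_transition hX hw η).2]
  rfl

omit [I.Boundaryless] [FiniteDimensional ℝ E] in
theorem tangent_ext {w : TangentBundle I M} {ξ η : TangentSpace I.tangent w}
    (h₁ : horizontalPart w ξ = horizontalPart w η)
    (h₂ : verticalPart S.g w ξ = verticalPart S.g w η) : ξ = η := by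
  rw [← lift_decomposition S.g w ξ, ← lift_decomposition S.g w η, h₁, h₂]

/-- An endomorphism field of the tangent bundle which acts on the horizontal and vertical parts as
`k` does in coordinates has components `endCoord`. -/
theorem inChart_eq_endCoord {K : EndField I.tangent (TangentBundle I M)}
    {k : E → E × E →L[ℝ] E × E} {u w : TangentBundle I M} {X : E × E}
    (hX : X.1 ∈ (extChartAt I u.proj).target) (hw : (extChartAt I.tangent u).symm X = w)
    (h : ∀ ξ : TangentSpace I.tangent w, ∀ a b : E,
      horizontalPart w ξ = fderiv ℝ (transition I u.proj w.proj) X.1 a →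
      verticalPart S.g w ξ = fderiv ℝ (transition I u.proj w.proj) X.1 b →
      horizontalPart w (K w ξ) = fderiv ℝ (transition I u.proj w.proj) X.1 (k X.1 (a, b)).1 ∧
      verticalPart S.g w (K w ξ) = fderiv ℝ (transition I u.proj w.proj) X.1 (k X.1 (a, b)).2) :
    K.inChart u X = endCoord (localChristoffel (S.g.inChart u.proj)) X k := by
  refine ContinuousLinearMap.ext fun ξ ↦ ?_
  refine K.inChart_eq_of (mem_extChartAt_tangent_target hX) hw ?_
  have h1 := S.adapted_fderiv_transition hX hw ξ
  have h2 := S.adapted_fderiv_transition hX hw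
    (endCoord (localChristoffel (S.g.inChart u.proj)) X k ξ)
  have h3 := h _ _ _ h1.1 h1.2
  rw [adapted_endCoord] at h2
  exact S.tangent_ext (h3.1.trans h2.1.symm) (h3.2.trans h2.2.symm)

theorem J₁_inChart {u : TangentBundle I M} {X : E × E}
    (hX : X.1 ∈ (extChartAt I u.proj).target) :
    S.J₁.inChart u X = endCoord (localChristoffel (S.g.inChart u.proj)) X frameJ₁ := by
  obtain ⟨w, hw⟩ : ∃ w, (extChartAt I.tangent u).symm X = w := ⟨_, rfl⟩
  refine S.inChart_eq_endCoord hX hw fun ξ a b ha hb ↦ ?_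
  constructor
  · refine Eq.trans (b := -verticalPart S.g w ξ) (by simp [J₁]) ?_
    rw [hb]
    exact (map_neg _ b).symm
  · exact Eq.trans (b := horizontalPart w ξ) (by simp [J₁]) ha

omit [FiniteDimensional ℝ E] in
theorem fderiv_transition_J_inChart {u w : TangentBundle I M} {X : E × E}
    (hX : X.1 ∈ (extChartAt I u.proj).target) (hw : (extChartAt I.tangent u).symm X = w) (a : E) :
    fderiv ℝ (transition I u.proj w.proj) X.1 (S.J.inChart u.proj X.1 a) =
      S.J w.proj (fderiv ℝ (transition I u.proj w.proj) X.1 a) :=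
  S.J.fderiv_transition_inChart hX (proj_extChartAt_tangent_symm hX hw) a

theorem J₂_inChart {u : TangentBundle I M} {X : E × E}
    (hX : X.1 ∈ (extChartAt I u.proj).target) :
    S.J₂.inChart u X = endCoord (localChristoffel (S.g.inChart u.proj)) X
      (frameJ₂ (S.J.inChart u.proj)) := by
  obtain ⟨w, hw⟩ : ∃ w, (extChartAt I.tangent u).symm X = w := ⟨_, rfl⟩
  refine S.inChart_eq_endCoord hX hw fun ξ a b ha hb ↦ ?_
  constructor
  · refine Eq.trans (b := S.J w.proj (verticalPart S.g w ξ)) (by simp [J₂]) ?_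
    rw [hb]
    exact (S.fderiv_transition_J_inChart hX hw b).symm
  · refine Eq.trans (b := S.J w.proj (horizontalPart w ξ)) (by simp [J₂]) ?_
    rw [ha]
    exact (S.fderiv_transition_J_inChart hX hw a).symm

theorem J₃_inChart {u : TangentBundle I M} {X : E × E}
    (hX : X.1 ∈ (extChartAt I u.proj).target) :
    S.J₃.inChart u X = endCoord (localChristoffel (S.g.inChart u.proj)) X
      (frameJ₃ (S.J.inChart u.proj)) := by
  obtain ⟨w, hw⟩ : ∃ w, (extChartAt I.tangent u).symm X = w := ⟨_, rfl⟩
  refine S.inChart_eq_endCoord hX hw fun ξ a b ha hb ↦ ?_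
  constructor
  · refine Eq.trans (b := -S.J w.proj (horizontalPart w ξ)) (by simp [J₃, J₁, J₂]) ?_
    rw [ha, ← S.fderiv_transition_J_inChart hX hw a]
    exact (map_neg _ _).symm
  · refine Eq.trans (b := S.J w.proj (verticalPart S.g w ξ)) (by simp [J₃, J₁, J₂]) ?_
    rw [hb]
    exact (S.fderiv_transition_J_inChart hX hw b).symm

omit [FiniteDimensional ℝ E] in
theorem extChartAt_tangent_self (u : TangentBundle I M) :
    extChartAt I.tangent u u = (extChartAt I u.proj u.proj, u.snd) := by
  rw [extChartAt_tangent_apply, fderiv_transition_self (mem_extChartAt_target u.proj)]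
  rfl

theorem lieForm_sasaki_eq {K : EndField I.tangent (TangentBundle I M)}
    {k : E → E × E →L[ℝ] E × E} (u : TangentBundle I M)
    (h : ∀ X : E × E, X.1 ∈ (extChartAt I u.proj).target →
      K.inChart u X = endCoord (localChristoffel (S.g.inChart u.proj)) X k) (ξ : E × E) :
    lieForm S.sasaki K u ξ =
      localLieForm (fun Y ↦ sasakiCoord (localChristoffel (S.g.inChart u.proj)) Y
          (S.g.inChart u.proj))
        (fun Y ↦ endCoord (localChristoffel (S.g.inChart u.proj)) Y k)
        (extChartAt I u.proj u.proj, u.snd) ξ := by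
  have hev : ∀ᶠ X : E × E in 𝓝 (extChartAt I u.proj u.proj, (u.snd : E)),
      X.1 ∈ (extChartAt I u.proj).target :=
    continuousAt_fst.eventually (target_mem_nhds (mem_extChartAt_target u.proj))
  rw [lieForm_eq, extChartAt_tangent_self]
  exact localLieForm_congr (hev.mono fun X hX ↦ S.sasaki_inChart hX) (hev.mono h) ξ

omit [FiniteDimensional ℝ E] in
theorem g_J_inChart_self (p : M) (a b : E) :
    S.g.inChart p (extChartAt I p p) (S.J.inChart p (extChartAt I p p) a) b =
      S.g.inChart p (extChartAt I p p) a (S.J.inChart p (extChartAt I p p) b) := by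
  rw [FormField.inChart_self, EndField.inChart_self]
  exact S.g_J_apply p a b

omit [I.Boundaryless] [FiniteDimensional ℝ E] in
theorem eq_adaptedSymm (u : TangentBundle I M) (ξ : TangentSpace I.tangent u) :
    (ξ : E × E) = adaptedSymm (localChristoffel (S.g.inChart u.proj))
      (extChartAt I u.proj u.proj, u.snd) (horizontalPart u ξ, verticalPart S.g u ξ) :=
  (adaptedSymm_adapted (localChristoffel (S.g.inChart u.proj))
    (extChartAt I u.proj u.proj, u.snd) ξ).symm

omit [FiniteDimensional ℝ E] in
theorem contDiffAt_two_g_inChart (p : M) :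
    ContDiffAt ℝ 2 (S.g.inChart p) (extChartAt I p p) :=
  (S.contDiffAt_g_inChart p).of_le (WithTop.coe_le_coe.2 (le_top : (2 : ℕ∞) ≤ ⊤))

omit [FiniteDimensional ℝ E] in
theorem differentiableAt_J_inChart (p : M) :
    DifferentiableAt ℝ (S.J.inChart p) (extChartAt I p p) :=
  (S.contDiffAt_J_inChart p).differentiableAt (by simp)

omit [FiniteDimensional ℝ E] in
theorem associatedRicci_zero_left (p : M) (z : TangentSpace I p) :
    associatedRicci S.g S.J p 0 z = 0 := by
  exact (associatedRicci_eq S.g S.J p 0 z).trans (localRicci_zero _ _ _ _)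

/-- The Lie form of `(J₁, ĝ)` vanishes. -/
theorem lieForm_J₁ (u : TangentBundle I M) (ξ : TangentSpace I.tangent u) :
    lieForm S.sasaki S.J₁ u ξ = 0 := by
  refine (S.lieForm_sasaki_eq u (fun X hX ↦ S.J₁_inChart hX) ξ).trans ?_
  refine (congrArg (localLieForm (E := E × E) _ _ _) (S.eq_adaptedSymm u ξ)).trans ?_
  exact localLieForm_frameJ₁ (S.contDiffAt_two_g_inChart u.proj)
    (S.eventually_isMetric_inChart (mem_extChartAt_target u.proj)) _

/-- The Lie form of `(J₂, ĝ)` at `X^H + Y^V` is `θ(Y) + ρ̃(X, u)`. -/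
theorem lieForm_J₂ (u : TangentBundle I M) (ξ : TangentSpace I.tangent u) :
    lieForm S.sasaki S.J₂ u ξ = lieForm S.g S.J u.proj (verticalPart S.g u ξ)
      + associatedRicci S.g S.J u.proj (horizontalPart u ξ) u.snd := by
  refine (S.lieForm_sasaki_eq u (fun X hX ↦ S.J₂_inChart hX) ξ).trans ?_
  refine (congrArg (localLieForm (E := E × E) _ _ _) (S.eq_adaptedSymm u ξ)).trans ?_
  refine (localLieForm_frameJ₂ (S.g_J_inChart_self u.proj) (S.contDiffAt_two_g_inChart u.proj)
    (S.eventually_isMetric_inChart (mem_extChartAt_target u.proj))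
    (S.differentiableAt_J_inChart u.proj) _).trans ?_
  exact congrArg₂ (· + ·) (lieForm_eq S.g S.J u.proj _).symm
    (associatedRicci_eq S.g S.J u.proj _ _).symm

/-- The Lie form of `(J₃, ĝ)` at `X^H + Y^V` is `-θ(X)`. -/
theorem lieForm_J₃ (u : TangentBundle I M) (ξ : TangentSpace I.tangent u) :
    lieForm S.sasaki S.J₃ u ξ = -lieForm S.g S.J u.proj (horizontalPart u ξ) := by
  refine (S.lieForm_sasaki_eq u (fun X hX ↦ S.J₃_inChart hX) ξ).trans ?_
  refine (congrArg (localLieForm (E := E × E) _ _ _) (S.eq_adaptedSymm u ξ)).trans ?_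
  refine (localLieForm_frameJ₃ (S.g_J_inChart_self u.proj) (S.contDiffAt_two_g_inChart u.proj)
    (S.eventually_isMetric_inChart (mem_extChartAt_target u.proj))
    (S.differentiableAt_J_inChart u.proj) _).trans ?_
  exact congrArg Neg.neg (lieForm_eq S.g S.J u.proj _).symm

end AlmostSkewHermitian

end Sasaki

end SkewHermitian

end

theorem mainTheorem10 (n : ℕ) {M : Type*} [TopologicalSpace M]
    [ChartedSpace (EuclideanSpace ℝ (Fin (2 * n))) M] [IsManifold (𝓡 (2 * n)) ∞ M]
    (S : SkewHermitian.AlmostSkewHermitian (𝓡 (2 * n)) M) :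
    (∀ (u : TangentBundle (𝓡 (2 * n)) M) (ξ : TangentSpace (𝓡 (2 * n)).tangent u),
        SkewHermitian.lieForm S.sasaki S.J₁ u ξ = 0) ∧
    ((∀ (u : TangentBundle (𝓡 (2 * n)) M) (ξ : TangentSpace (𝓡 (2 * n)).tangent u),
        SkewHermitian.lieForm S.sasaki S.J₂ u ξ = 0) ↔
      (∀ (p : M) (z : TangentSpace (𝓡 (2 * n)) p), SkewHermitian.lieForm S.g S.J p z = 0) ∧
      (∀ (p : M) (y z : TangentSpace (𝓡 (2 * n)) p),
        SkewHermitian.associatedRicci S.g S.J p y z = 0)) ∧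
    ((∀ (u : TangentBundle (𝓡 (2 * n)) M) (ξ : TangentSpace (𝓡 (2 * n)).tangent u),
        SkewHermitian.lieForm S.sasaki S.J₃ u ξ = 0) ↔
      (∀ (p : M) (z : TangentSpace (𝓡 (2 * n)) p),
        SkewHermitian.lieForm S.g S.J p z = 0)) := by
  have hθ (h : ∀ (u : TangentBundle (𝓡 (2 * n)) M) (ξ : TangentSpace (𝓡 (2 * n)).tangent u),
      SkewHermitian.lieForm S.sasaki S.J₂ u ξ = 0) (p : M) (z : TangentSpace (𝓡 (2 * n)) p) :
      SkewHermitian.lieForm S.g S.J p z = 0 := by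
    -- A vertical vector has zero horizontal part, so only `θ` survives in the formula for `θ₂`.
    have h1 := h ⟨p, 0⟩ (SkewHermitian.verticalLift ⟨p, 0⟩ z)
    rwa [S.lieForm_J₂, SkewHermitian.verticalPart_verticalLift,
      SkewHermitian.horizontalPart_verticalLift, S.associatedRicci_zero_left, add_zero] at h1
  refine ⟨S.lieForm_J₁, ⟨fun h ↦ ⟨hθ h, fun p y z ↦ ?_⟩, fun h u ξ ↦ ?_⟩,
    ⟨fun h p z ↦ ?_, fun h u ξ ↦ ?_⟩⟩
  · have h1 := h ⟨p, z⟩ (SkewHermitian.horizontalLift S.g ⟨p, z⟩ y)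
    rwa [S.lieForm_J₂, hθ h, zero_add, SkewHermitian.horizontalPart_horizontalLift] at h1
  · rw [S.lieForm_J₂, h.1, h.2, add_zero]
  · have h1 := h ⟨p, 0⟩ (SkewHermitian.horizontalLift S.g ⟨p, 0⟩ z)
    rw [S.lieForm_J₃, SkewHermitian.horizontalPart_horizontalLift] at h1
    exact neg_eq_zero.1 h1
  · rw [S.lieForm_J₃, h, neg_zero]
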